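/- Let $\mathcal F^2(\mathbb C)$ be the Fock space of entire functions $f$ with $\|f\|^2=\frac1\pi\int_{\mathbb C}|f(z)|^2e^{-|z|^2}\,dV(z)<\infty$. Let $a,b,c\in\mathbb C$ satisfy $|a|=1$, $\bar a b+\bar b=0$ and $|c|^2e^{|b|^2}=1$, and let $\mathcal C_{a,b,c}f(z)=ce^{bz}\overline{f(\overline{az+b})}$, a conjugation (anti-linear, involutive, isometric map) of $\mathcal F^2(\mathbb C)$. A closed, densely defined operator $T$ on $\mathcal F^2(\mathbb C)$ is called $\mathcal C_{a,b,c}$-selfadjoint if $T=\mathcal C_{a,b,c}T^*\mathcal C_{a,b,c}$ (with equality of domains). Let $\psi_0,\psi_1$ be entire functions, let $T_{\max}f=\psi_0f+\psi_1f'$ with domain $\{f\in\mathcal F^2(\mathbb C):\psi_0f+\psi_1f'\in\mathcal F^2(\mathbb C)\}$, and let $T$ be the restriction of $T_{\max}$ to a linear subspace of this domain. Then $T$ is $\mathcal C_{a,b,c}$-selfadjoint if and only if $T=T_{\max}$ and $$\psi_0(z)=d_{0,0}+d_{1,0}(az+b),\qquad \psi_1(z)=d_{0,1}+d_{1,1}(az+b)\qquad\text{for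 all } z\in\mathbb C,$$ for some constants $d_{i,j}\in\mathbb C$ with $d_{1,0}=d_{0,1}$. In this case the point spectrum $\sigma_p(T)$ (the set of eigenvalues of $T$) is $$\sigma_p(T)=\begin{cases}\{\psi_0(w)+k\,\psi_1'(w):k=0,1,2,\dots\},\quad w=\dfrac{-d_{0,1}-b\,d_{1,1}}{a\,d_{1,1}},&\text{if } d_{1,1}\neq0,\\[1ex] \emptyset,&\text{if } d_{1,1}=0,\ d_{0,1}\neq0,\\ \{d_{0,0}\},&\text{if } d_{1,1}=d_{0,1}=0.\end{cases}$$ -/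

import Mathlib

open MeasureTheory Complex Filter Topology
open scoped ComplexConjugate ENNReal

/-- The density `z ↦ π⁻¹ exp (-|z|²)` on `ℂ`. -/
noncomputable def fockWeight (z : ℂ) : ℝ := Real.exp (-‖z‖ ^ 2) / Real.pi

/-- The Gaussian measure `π⁻¹ exp (-|z|²) dV(z)` on `ℂ`, with `dV` the Lebesgue measure. -/
noncomputable def fockMeasure : Measure ℂ :=
  (volume : Measure ℂ).withDensity fun z => ENNReal.ofReal (fockWeight z)

theorem fockWeight_pos (z : ℂ) : 0 < fockWeight z := by unfold fockWeight; positivity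

theorem continuous_fockWeight : Continuous fockWeight := by unfold fockWeight; fun_prop

theorem integral_fockMeasure {E : Type*} [NormedAddCommGroup E] [NormedSpace ℝ E] (g : ℂ → E) :
    ∫ z, g z ∂fockMeasure = ∫ z, fockWeight z • g z := by
  unfold fockMeasure
  rw [integral_withDensity_eq_integral_toReal_smul
    (continuous_fockWeight.measurable.ennreal_ofReal) (by simp)]
  simp [ENNReal.toReal_ofReal (fockWeight_pos _).le]

theorem integrable_fockMeasure_iff {E : Type*} [NormedAddCommGroup E] [NormedSpace ℝ E]
    (g : ℂ → E) : Integrable g fockMeasure ↔ Integrable (fun z => fockWeight z • g z) := by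
  unfold fockMeasure
  rw [integrable_withDensity_iff_integrable_smul'
    (continuous_fockWeight.measurable.ennreal_ofReal) (by simp)]
  simp [ENNReal.toReal_ofReal (fockWeight_pos _).le]

theorem volume_absolutelyContinuous_fockMeasure : (volume : Measure ℂ) ≪ fockMeasure :=
  withDensity_absolutelyContinuous'
    (continuous_fockWeight.measurable.ennreal_ofReal).aemeasurable
    (by simp [fockWeight_pos])

instance : fockMeasure.IsOpenPosMeasure :=
  volume_absolutelyContinuous_fockMeasure.isOpenPosMeasure

/-- The Fock space: the entire functions that are square integrable for the Gaussian measure. -/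
structure FockSpace where
  /-- The underlying entire function. -/
  toFun : ℂ → ℂ
  differentiable' : Differentiable ℂ toFun
  memLp' : MemLp toFun 2 fockMeasure

namespace FockSpace

instance : FunLike FockSpace ℂ ℂ where
  coe f := f.toFun
  coe_injective := by rintro ⟨⟩ ⟨⟩ h; congr

theorem differentiable (f : FockSpace) : Differentiable ℂ f := f.differentiable'
theorem memLp (f : FockSpace) : MemLp f 2 fockMeasure := f.memLp'

@[ext] theorem ext {f g : FockSpace} (h : ∀ z, f z = g z) : f = g := DFunLike.ext f g h

noncomputable instance : Zero FockSpace := ⟨⟨0, differentiable_const _, MemLp.zero⟩⟩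
noncomputable instance : Add FockSpace :=
  ⟨fun f g => ⟨f + g, f.differentiable.add g.differentiable, f.memLp.add g.memLp⟩⟩
noncomputable instance : Neg FockSpace := ⟨fun f => ⟨-f, f.differentiable.neg, f.memLp.neg⟩⟩
noncomputable instance : Sub FockSpace :=
  ⟨fun f g => ⟨f - g, f.differentiable.sub g.differentiable, f.memLp.sub g.memLp⟩⟩
noncomputable instance : SMul ℂ FockSpace :=
  ⟨fun c f => ⟨c • f, f.differentiable.const_smul c, f.memLp.const_smul c⟩⟩
noncomputable instance : SMul ℕ FockSpace := ⟨fun n f => (n : ℂ) • f⟩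
noncomputable instance : SMul ℤ FockSpace := ⟨fun n f => (n : ℂ) • f⟩

noncomputable instance : AddCommGroup FockSpace :=
  DFunLike.coe_injective.addCommGroup _ rfl (fun _ _ => rfl) (fun _ => rfl) (fun _ _ => rfl)
    (fun f n => (Nat.cast_smul_eq_nsmul ℂ n (f : ℂ → ℂ)))
    (fun f n => (Int.cast_smul_eq_zsmul ℂ n (f : ℂ → ℂ)))

/-- Passing to the underlying function, as an additive map. -/
noncomputable def coeHom : FockSpace →+ (ℂ → ℂ) where
  toFun f := f
  map_zero' := rfl
  map_add' _ _ := rfl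

noncomputable instance : Module ℂ FockSpace :=
  DFunLike.coe_injective.module ℂ coeHom (fun _ _ => rfl)

@[simp] theorem mk_apply (f : ℂ → ℂ) (h₁ h₂) (z : ℂ) : (⟨f, h₁, h₂⟩ : FockSpace) z = f z := rfl
@[simp] theorem zero_apply (z : ℂ) : (0 : FockSpace) z = 0 := rfl
@[simp] theorem add_apply (f g : FockSpace) (z : ℂ) : (f + g) z = f z + g z := rfl
@[simp] theorem neg_apply (f : FockSpace) (z : ℂ) : (-f) z = -f z := rfl
@[simp] theorem sub_apply (f g : FockSpace) (z : ℂ) : (f - g) z = f z - g z := rfl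
@[simp] theorem smul_apply (c : ℂ) (f : FockSpace) (z : ℂ) : (c • f) z = c * f z := rfl

theorem integrable_conj_mul (f g : FockSpace) :
    Integrable (fun z => conj (f z) * g z) fockMeasure := by
  have := L2.integrable_inner (𝕜 := ℂ) f.memLp.toLp g.memLp.toLp
  refine this.congr ?_
  filter_upwards [f.memLp.coeFn_toLp, g.memLp.coeFn_toLp] with z h1 h2
  rw [h1, h2, RCLike.inner_apply']

/-- The inner product `∫ conj (f z) g z dμ(z)`, conjugate linear in the first variable as
everywhere in Mathlib. -/
@[reducible]
noncomputable def core : InnerProductSpace.Core ℂ FockSpace where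
  inner f g := ∫ z, conj (f z) * g z ∂fockMeasure
  conj_inner_symm f g := by
    rw [← integral_conj]; congr 1; ext z; simp [mul_comm]
  re_inner_nonneg f := by
    have : ∀ z, conj (f z) * f z = ((‖f z‖ ^ 2 : ℝ) : ℂ) := fun z => by
      rw [mul_comm, mul_conj, normSq_eq_norm_sq]
    simp_rw [this]
    rw [integral_complex_ofReal]
    exact integral_nonneg fun z => by positivity
  add_left f g h := by
    rw [← integral_add (integrable_conj_mul f h) (integrable_conj_mul g h)]
    congr 1; ext z; simp [add_mul]
  smul_left f g r := by
    rw [← integral_const_mul]; congr 1; ext z; simp [mul_assoc]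
  definite f hf := by
    have h0 : ∀ z, conj (f z) * f z = ((‖f z‖ ^ 2 : ℝ) : ℂ) := fun z => by
      rw [mul_comm, mul_conj, normSq_eq_norm_sq]
    simp_rw [h0] at hf
    rw [integral_complex_ofReal] at hf
    have hf' : ∫ z, ‖f z‖ ^ 2 ∂fockMeasure = 0 := by exact_mod_cast hf
    have hi : Integrable (fun z => ‖f z‖ ^ 2) fockMeasure :=
      (memLp_two_iff_integrable_sq_norm f.memLp.1).1 f.memLp
    rw [integral_eq_zero_iff_of_nonneg (fun z => by positivity) hi] at hf'
    have hc : Continuous fun z => ‖f z‖ ^ 2 := by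
      have := f.differentiable.continuous; fun_prop
    have := hc.ae_eq_iff_eq (g := 0) fockMeasure continuous_const |>.1 hf'
    ext z
    simpa using congrFun this z

noncomputable instance : NormedAddCommGroup FockSpace := core.toNormedAddCommGroup
noncomputable instance : InnerProductSpace ℂ FockSpace := InnerProductSpace.ofCore core.toCore

theorem inner_def (f g : FockSpace) :
    inner ℂ f g = ∫ z, conj (f z) * g z ∂fockMeasure := rfl

theorem norm_sq_eq (f : FockSpace) : ‖f‖ ^ 2 = ∫ z, ‖f z‖ ^ 2 ∂fockMeasure := by
  rw [← inner_self_eq_norm_sq (𝕜 := ℂ), inner_def, ← integral_re (integrable_conj_mul f f)]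
  congr 1; ext z
  rw [mul_comm, RCLike.mul_conj]
  norm_cast

/-- The mean value property over the disc of radius one. -/
theorem _root_.integral_ball_of_differentiable {f : ℂ → ℂ} (hf : Differentiable ℂ f) (w : ℂ) :
    ∫ z in Metric.ball w 1, f z = Real.pi * f w := by
  have h1 : ∫ z in Metric.ball w 1, f z
      = ∫ z, (Metric.ball (0 : ℂ) 1).indicator (fun z => f (w + z)) z := by
    rw [← integral_indicator Metric.isOpen_ball.measurableSet,
      ← integral_add_left_eq_self _ w]
    congr 1; ext z
    simp [Set.indicator, Metric.mem_ball, dist_eq_norm]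
  rw [h1, ← Complex.integral_comp_polarCoord_symm]
  have h2 : ∫ p in polarCoord.target, p.1 • (Metric.ball (0 : ℂ) 1).indicator
        (fun z => f (w + z)) (Complex.polarCoord.symm p)
      = ∫ p in (Set.Ioo (0 : ℝ) 1) ×ˢ (Set.Ioo (-Real.pi) Real.pi),
          p.1 • f (circleMap w p.1 p.2) := by
    have hs : (Set.Ioo (0 : ℝ) 1) ×ˢ (Set.Ioo (-Real.pi) Real.pi) ⊆ polarCoord.target := by
      rintro ⟨r, t⟩ ⟨hr, ht⟩; exact ⟨hr.1, ht⟩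
    rw [setIntegral_eq_of_subset_of_forall_sdiff_eq_zero
      polarCoord.open_target.measurableSet hs]
    · refine setIntegral_congr_fun (measurableSet_Ioo.prod measurableSet_Ioo) ?_
      rintro ⟨r, t⟩ ⟨hr, ht⟩
      have : (Complex.polarCoord.symm (r, t)) ∈ Metric.ball (0 : ℂ) 1 := by
        rw [mem_ball_zero_iff, Complex.norm_polarCoord_symm, abs_of_pos hr.1]
        exact hr.2
      simp only [Set.indicator_of_mem this]
      congr 2
      simp [Complex.polarCoord_symm_apply, circleMap, Complex.exp_mul_I]
    · rintro ⟨r, t⟩ ⟨⟨hr, ht⟩, hn⟩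
      have : (Complex.polarCoord.symm (r, t)) ∉ Metric.ball (0 : ℂ) 1 := by
        intro h
        apply hn
        have hr' : (0 : ℝ) < r := hr
        rw [mem_ball_zero_iff, Complex.norm_polarCoord_symm, abs_of_pos hr'] at h
        exact ⟨⟨hr, h⟩, ht⟩
      simp only [Set.indicator_of_notMem this, smul_zero]
  rw [h2]
  have hcont : Continuous fun p : ℝ × ℝ => p.1 • f (circleMap w p.1 p.2) := by
    have := hf.continuous
    unfold circleMap
    fun_prop
  have hint : IntegrableOn (fun p : ℝ × ℝ => p.1 • f (circleMap w p.1 p.2))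
      ((Set.Ioo (0 : ℝ) 1) ×ˢ (Set.Ioo (-Real.pi) Real.pi)) (volume.prod volume) := by
    refine (hcont.continuousOn.integrableOn_compact
      (isCompact_Icc.prod isCompact_Icc)).mono_set
      (Set.prod_mono Set.Ioo_subset_Icc_self Set.Ioo_subset_Icc_self)
  rw [Measure.volume_eq_prod, setIntegral_prod _ hint]
  have h3 : ∀ r : ℝ, ∫ t in Set.Ioo (-Real.pi) Real.pi, r • f (circleMap w r t)
      = r • ((2 * Real.pi) • f w) := by
    intro r
    rw [integral_smul]
    congr 1
    have hav := (hf.diffContOnCl (s := Metric.ball w |r|)).circleAverage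
    rw [Real.circleAverage_def] at hav
    rw [← hav, smul_smul, mul_inv_cancel₀ (by positivity), one_smul,
      ← integral_Ioc_eq_integral_Ioo, ← intervalIntegral.integral_of_le (by linarith [Real.pi_pos])]
    have hp : Function.Periodic (fun t => f (circleMap w r t)) (2 * Real.pi) := fun t => by
      simp [periodic_circleMap w r t]
    have := hp.intervalIntegral_add_eq (-Real.pi) 0
    rw [zero_add] at this
    rw [← this]
    congr 1; ring
  simp_rw [h3]
  rw [integral_smul_const, ← integral_Ioc_eq_integral_Ioo,
    ← intervalIntegral.integral_of_le zero_le_one, integral_id]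
  simp only [real_smul]
  push_cast
  ring

/-- Point evaluations are bounded on the Fock space. -/
theorem norm_apply_sq_le (f : FockSpace) (w : ℂ) :
    ‖f w‖ ^ 2 ≤ Real.exp ((‖w‖ + 1) ^ 2) * ‖f‖ ^ 2 := by
  have hd : Differentiable ℂ fun z => f z ^ 2 := f.differentiable.pow 2
  have h := integral_ball_of_differentiable hd w
  have hi : Integrable (fun z => fockWeight z • ‖f z‖ ^ 2) :=
    (integrable_fockMeasure_iff _).1 ((memLp_two_iff_integrable_sq_norm f.memLp.1).1 f.memLp)
  have h1 : Real.pi * ‖f w‖ ^ 2 ≤ ∫ z in Metric.ball w 1, ‖f z‖ ^ 2 := by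
    have := norm_integral_le_integral_norm (μ := volume.restrict (Metric.ball w 1))
      (fun z => f z ^ 2)
    rw [h] at this
    simpa [abs_of_pos Real.pi_pos] using this
  have hcf := f.differentiable.continuous
  have hI : IntegrableOn (fun z => ‖f z‖ ^ 2) (Metric.ball w 1) :=
    ((by fun_prop : Continuous fun z => ‖f z‖ ^ 2).continuousOn.integrableOn_compact
      (isCompact_closedBall w 1)).mono_set Metric.ball_subset_closedBall
  have h2 : ∫ z in Metric.ball w 1, ‖f z‖ ^ 2 ≤
      ∫ z in Metric.ball w 1,
        (Real.pi * Real.exp ((‖w‖ + 1) ^ 2)) * (fockWeight z • ‖f z‖ ^ 2) := by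
    refine setIntegral_mono_on hI (hi.integrableOn.const_mul _) Metric.isOpen_ball.measurableSet ?_
    intro z hz
    have hz' : ‖z‖ ≤ ‖w‖ + 1 := by
      have : ‖z - w‖ < 1 := by simpa [dist_eq_norm] using hz
      linarith [norm_le_norm_add_norm_sub' z w]
    have h3 : 1 ≤ Real.pi * Real.exp ((‖w‖ + 1) ^ 2) * fockWeight z := by
      unfold fockWeight
      have : Real.pi * Real.exp ((‖w‖ + 1) ^ 2) * (Real.exp (-‖z‖ ^ 2) / Real.pi)
          = Real.exp ((‖w‖ + 1) ^ 2 - ‖z‖ ^ 2) := by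
        rw [Real.exp_sub, Real.exp_neg]; field_simp
      rw [this, Real.one_le_exp_iff, sub_nonneg]
      gcongr
    rw [smul_eq_mul, ← mul_assoc]
    exact le_mul_of_one_le_left (by positivity) h3
  have h3 : ∫ z in Metric.ball w 1, fockWeight z • ‖f z‖ ^ 2 ≤ ‖f‖ ^ 2 := by
    rw [norm_sq_eq, integral_fockMeasure]
    exact setIntegral_le_integral hi
      (Eventually.of_forall fun z => smul_nonneg (fockWeight_pos z).le (by positivity))
  rw [integral_const_mul] at h2
  have h4 := h1.trans h2
  rw [mul_assoc] at h4
  have h5 := le_of_mul_le_mul_left h4 Real.pi_pos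
  exact h5.trans (by gcongr)

theorem norm_apply_le (f : FockSpace) (w : ℂ) :
    ‖f w‖ ≤ Real.exp ((‖w‖ + 1) ^ 2) * ‖f‖ := by
  refine abs_le_of_sq_le_sq' ?_ (by positivity) |>.2
  refine (norm_apply_sq_le f w).trans ?_
  rw [mul_pow]
  gcongr
  exact le_self_pow₀ (Real.one_le_exp (by positivity)) two_ne_zero

/-- The isometric embedding of the Fock space into `L²`. -/
noncomputable def toL2 : FockSpace →ₗᵢ[ℂ] Lp ℂ 2 fockMeasure where
  toFun f := f.memLp.toLp
  map_add' f g := rfl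
  map_smul' c f := rfl
  norm_map' f := by
    have h : ‖f.memLp.toLp‖ ^ 2 = ‖f‖ ^ 2 := by
      rw [norm_sq_eq, ← inner_self_eq_norm_sq (𝕜 := ℂ), L2.inner_def,
        ← integral_re (L2.integrable_inner _ _)]
      refine integral_congr_ae ?_
      filter_upwards [f.memLp.coeFn_toLp] with z h1
      rw [h1, inner_self_eq_norm_sq]
    exact (sq_eq_sq₀ (norm_nonneg _) (norm_nonneg _)).1 h

instance : CompleteSpace FockSpace := by
  refine Metric.complete_of_cauchySeq_tendsto fun u hu => ?_
  obtain ⟨F, hF⟩ := cauchySeq_tendsto_of_complete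
    (toL2.isometry.uniformContinuous.comp_cauchySeq hu)
  have hloc : ∀ w : ℂ, CauchySeq fun n => u n w := by
    intro w
    rw [Metric.cauchySeq_iff] at hu ⊢
    intro ε hε
    obtain ⟨N, hN⟩ := hu (ε / Real.exp ((‖w‖ + 1) ^ 2)) (by positivity)
    refine ⟨N, fun m hm n hn => ?_⟩
    have h1 := hN m hm n hn
    rw [dist_eq_norm, lt_div_iff₀ (by positivity)] at h1
    rw [dist_eq_norm, ← sub_apply]
    linarith [norm_apply_le (u m - u n) w]
  choose g hg using fun w => cauchySeq_tendsto_of_complete (hloc w)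
  have hunif : TendstoLocallyUniformlyOn (fun n z => u n z) g atTop Set.univ := by
    rw [tendstoLocallyUniformlyOn_univ, tendstoLocallyUniformly_iff_forall_isCompact]
    intro K hK
    obtain ⟨R, hR⟩ := hK.isBounded.exists_norm_le
    have : UniformCauchySeqOn (fun n z => u n z) atTop K := by
      rw [Metric.uniformCauchySeqOn_iff]
      rw [Metric.cauchySeq_iff] at hu
      intro ε hε
      obtain ⟨N, hN⟩ := hu (ε / Real.exp ((R + 1) ^ 2)) (by positivity)
      refine ⟨N, fun m hm n hn w hw => ?_⟩
      have h1 := hN m hm n hn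
      rw [dist_eq_norm, lt_div_iff₀ (by positivity)] at h1
      rw [dist_eq_norm, ← sub_apply]
      have h2 := norm_apply_le (u m - u n) w
      have h3 : Real.exp ((‖w‖ + 1) ^ 2) ≤ Real.exp ((R + 1) ^ 2) := by
        have := hR w hw
        gcongr
      have := mul_le_mul_of_nonneg_right h3 (norm_nonneg (u m - u n))
      linarith
    exact this.tendstoUniformlyOn_of_tendsto fun w _ => hg w
  have hgd : Differentiable ℂ g := by
    rw [← differentiableOn_univ]
    exact hunif.differentiableOn
      (Eventually.of_forall fun n => (u n).differentiable.differentiableOn) isOpen_univ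
  have hae : F =ᵐ[fockMeasure] g := by
    obtain ⟨ns, hns, h⟩ := (tendstoInMeasure_of_tendsto_Lp hF).exists_seq_tendsto_ae
    have hall : ∀ᵐ z ∂fockMeasure, ∀ n, toL2 (u n) z = u n z :=
      ae_all_iff.2 fun n => (u n).memLp.coeFn_toLp
    filter_upwards [h, hall] with z h1 h2
    refine tendsto_nhds_unique h1 ?_
    simp only [Function.comp_apply, h2]
    exact (hg z).comp hns.tendsto_atTop
  have hgL : MemLp g 2 fockMeasure := (memLp_congr_ae hae).1 (Lp.memLp F)
  let G : FockSpace := ⟨g, hgd, hgL⟩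
  have hG : toL2 G = F := by
    refine Lp.ext ?_
    exact hgL.coeFn_toLp.trans hae.symm
  refine ⟨G, ?_⟩
  rw [← hG] at hF
  exact toL2.isometry.isUniformInducing.isInducing.tendsto_nhds_iff.2 hF

end FockSpace

/-- A conjugation: an anti-linear, involutive and isometric map. -/
structure Conjugation (H : Type*) [NormedAddCommGroup H] [InnerProductSpace ℂ H] extends
    H →ₛₗ[starRingEnd ℂ] H where
  involutive' : ∀ x, toFun (toFun x) = x
  norm_map' : ∀ x, ‖toFun x‖ = ‖x‖

namespace Conjugation

variable {H : Type*} [NormedAddCommGroup H] [InnerProductSpace ℂ H]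

/-- The unbounded operator `C A C`, with domain `{f | C f ∈ dom A}`. -/
def conjugate (C : Conjugation H) (A : H →ₗ.[ℂ] H) : H →ₗ.[ℂ] H where
  domain := A.domain.comap C.toLinearMap
  toFun :=
    { toFun := fun f => C.toLinearMap (A ⟨C.toLinearMap f, f.2⟩)
      map_add' := fun f g => by
        rw [← map_add, ← LinearPMap.map_add]
        congr 2
        exact Subtype.ext (map_add C.toLinearMap (f : H) (g : H))
      map_smul' := fun r f => by
        have h : (⟨C.toLinearMap ((r • f : A.domain.comap C.toLinearMap) : H), (r • f).2⟩ :
            A.domain) = (starRingEnd ℂ r) • ⟨C.toLinearMap f, f.2⟩ :=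
          Subtype.ext (map_smulₛₗ C.toLinearMap r (f : H))
        rw [h, LinearPMap.map_smul, map_smulₛₗ, Complex.conj_conj]
        rfl }

end Conjugation

section Operators

variable {H : Type*} [NormedAddCommGroup H] [InnerProductSpace ℂ H]

/-- A closed, densely defined operator `T` is `C`-selfadjoint if `T = C T* C`. -/
def IsCSelfadjoint [CompleteSpace H] (C : Conjugation H) (T : H →ₗ.[ℂ] H) : Prop :=
  T.IsClosed ∧ Dense (T.domain : Set H) ∧ T = C.conjugate T.adjoint

/-- The point spectrum: the set of eigenvalues. -/
def pointSpectrum (T : H →ₗ.[ℂ] H) : Set ℂ :=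
  {μ | ∃ f : T.domain, (f : H) ≠ 0 ∧ T f = μ • (f : H)}

end Operators

/-- The conditions on `a`, `b`, `c` under which `f ↦ c e^{bz} conj (f (conj (a z + b)))` is a
conjugation of the Fock space. -/
structure IsConjugationParam (a b c : ℂ) : Prop where
  norm_a : ‖a‖ = 1
  ab : conj a * b + conj b = 0
  c_b : ‖c‖ ^ 2 * Real.exp (‖b‖ ^ 2) = 1

namespace IsConjugationParam

variable {a b c : ℂ}

theorem a_mul_conj (h : IsConjugationParam a b c) : a * conj a = 1 := by
  rw [mul_conj, normSq_eq_norm_sq, h.norm_a]; simp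

theorem a_mul_conj_b (h : IsConjugationParam a b c) : a * conj b = -b := by
  linear_combination a * h.ab - b * h.a_mul_conj

theorem affine_affine (h : IsConjugationParam a b c) (z : ℂ) :
    conj (a * conj (a * z + b) + b) = z := by
  have h1 := congrArg conj h.a_mul_conj
  have h2 := congrArg conj h.a_mul_conj_b
  simp only [map_add, map_mul, conj_conj, map_neg, map_one] at h1 h2 ⊢
  linear_combination z * h1 + h2

theorem weight_identity (h : IsConjugationParam a b c) (z : ℂ) :
    fockWeight z * ‖c * exp (b * z)‖ ^ 2 = fockWeight (conj (a * z + b)) := by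
  have e1 : ‖conj (a * z + b)‖ ^ 2 = ‖z‖ ^ 2 - 2 * (b * z).re + ‖b‖ ^ 2 := by
    have h1 := h.a_mul_conj
    have h2 := h.a_mul_conj_b
    have h3 := congrArg conj h2
    rw [← ofReal_inj]
    have h4 : (((b * z).re : ℝ) : ℂ) = (b * z + conj (b * z)) / 2 := re_eq_add_conj _
    push_cast
    rw [h4, ← mul_conj', ← mul_conj', ← mul_conj']
    simp only [map_add, map_mul, conj_conj, map_neg] at h3 ⊢
    linear_combination z * conj z * h1 + z * h2 + conj z * h3
  have hc := h.c_b
  unfold fockWeight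
  rw [e1, norm_mul, mul_pow, norm_exp, ← Real.exp_nat_mul]
  have : ‖c‖ ^ 2 = Real.exp (-‖b‖ ^ 2) := by
    rw [Real.exp_neg]; exact eq_inv_of_mul_eq_one_left hc
  rw [this]
  have : Real.exp (-(‖z‖ ^ 2 - 2 * (b * z).re + ‖b‖ ^ 2))
      = Real.exp (-‖z‖ ^ 2) * (Real.exp (-‖b‖ ^ 2) * Real.exp ((2 : ℕ) * (b * z).re)) := by
    rw [← Real.exp_add, ← Real.exp_add]; congr 1; push_cast; ring
  rw [this]; ring

theorem measurePreserving (h : IsConjugationParam a b c) :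
    MeasurePreserving (fun z : ℂ => conj (a * z + b)) := by
  obtain ⟨u, hu⟩ : ∃ u : Circle, (u : ℂ) = a :=
    ⟨⟨a, mem_sphere_zero_iff_norm.2 h.norm_a⟩, rfl⟩
  let e : ℂ ≃ₗᵢ[ℝ] ℂ := (rotation u).trans conjLIE
  have h1 := (measurePreserving_add_right (volume : Measure ℂ) (conj b)).comp e.measurePreserving
  have h2 : (fun z : ℂ => conj (a * z + b)) = (fun x => x + conj b) ∘ e := by
    funext z
    simp [e, hu]
  rw [h2]
  exact h1

/-- The change of variables behind the isometry of the conjugation. -/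
theorem integrable_comp_iff (h : IsConjugationParam a b c) {g : ℂ → ℝ} (hg : Continuous g) :
    Integrable (fun z => ‖c * exp (b * z)‖ ^ 2 * g (conj (a * z + b))) fockMeasure
      ↔ Integrable g fockMeasure := by
  rw [integrable_fockMeasure_iff, integrable_fockMeasure_iff]
  have hm : AEStronglyMeasurable (fun z => fockWeight z • g z) (volume : Measure ℂ) :=
    (continuous_fockWeight.smul hg).aestronglyMeasurable
  rw [← h.measurePreserving.integrable_comp hm]
  simp only [Function.comp_def, smul_eq_mul, ← mul_assoc, h.weight_identity]

theorem integral_comp (h : IsConjugationParam a b c) {g : ℂ → ℝ} (hg : Continuous g) :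
    ∫ z, ‖c * exp (b * z)‖ ^ 2 * g (conj (a * z + b)) ∂fockMeasure = ∫ z, g z ∂fockMeasure := by
  rw [integral_fockMeasure, integral_fockMeasure]
  have hm : AEStronglyMeasurable (fun z => fockWeight z • g z)
      (Measure.map (fun z : ℂ => conj (a * z + b)) volume) :=
    (continuous_fockWeight.smul hg).aestronglyMeasurable
  have h1 := integral_map h.measurePreserving.measurable.aemeasurable hm
  rw [h.measurePreserving.map_eq] at h1
  rw [h1]
  simp only [smul_eq_mul, ← mul_assoc, h.weight_identity]

theorem norm_sq_wcc (f : FockSpace) (z : ℂ) :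
    ‖c * exp (b * z) * conj (f (conj (a * z + b)))‖ ^ 2
      = ‖c * exp (b * z)‖ ^ 2 * ‖f (conj (a * z + b))‖ ^ 2 := by
  rw [norm_mul (c * exp (b * z)), mul_pow, RCLike.norm_conj]

theorem differentiable_wcc (f : FockSpace) :
    Differentiable ℂ fun z => c * exp (b * z) * conj (f (conj (a * z + b))) := by
  have h1 : Differentiable ℂ (conj ∘ f ∘ conj) := fun z =>
    differentiableAt_conj_conj_iff.2 (f.differentiable _)
  have h2 : Differentiable ℂ fun z : ℂ => a * z + b := by fun_prop
  have h3 : Differentiable ℂ fun z : ℂ => c * exp (b * z) := by fun_prop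
  exact h3.mul (h1.comp h2)

end IsConjugationParam

/-- The weighted composition conjugation `f ↦ c e^{bz} conj (f (conj (a z + b)))`. -/
noncomputable def weightedConjugation {a b c : ℂ} (h : IsConjugationParam a b c) :
    Conjugation FockSpace where
  toFun f :=
    { toFun := fun z => c * exp (b * z) * conj (f (conj (a * z + b)))
      differentiable' := IsConjugationParam.differentiable_wcc f
      memLp' := by
        rw [memLp_two_iff_integrable_sq_norm
          (IsConjugationParam.differentiable_wcc f).continuous.aestronglyMeasurable]
        simp only [IsConjugationParam.norm_sq_wcc]
        have hc := f.differentiable.continuous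
        refine (h.integrable_comp_iff (g := fun z => ‖f z‖ ^ 2) (by fun_prop)).2 ?_
        exact (memLp_two_iff_integrable_sq_norm f.memLp.1).1 f.memLp }
  map_add' f g := by
    ext z; simp [mul_add]
  map_smul' r f := by
    ext z; simp [mul_left_comm]
  involutive' f := by
    ext z
    have h1 : c * exp (b * z) * conj (c * exp (b * conj (a * z + b))) = 1 := by
      have h2 := h.a_mul_conj_b
      have h3 := congrArg (fun x : ℝ => (x : ℂ)) h.c_b
      simp only [ofReal_mul, ofReal_pow, ofReal_exp, ofReal_one, ← mul_conj'] at h3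
      have h4 : exp (b * z) * conj (exp (b * conj (a * z + b))) = exp (b * conj b) := by
        rw [← exp_conj, ← exp_add]
        congr 1
        simp only [map_add, map_mul, conj_conj]
        linear_combination z * h2
      rw [map_mul]
      linear_combination c * conj c * h4 + h3
    have h2 := h.affine_affine z
    simp only [FockSpace.mk_apply, map_mul, conj_conj] at h1 ⊢
    rw [h2]
    linear_combination f z * h1
  norm_map' f := by
    refine (sq_eq_sq₀ (norm_nonneg _) (norm_nonneg _)).1 ?_
    rw [FockSpace.norm_sq_eq, FockSpace.norm_sq_eq]
    simp only [FockSpace.mk_apply, IsConjugationParam.norm_sq_wcc]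
    have hc := f.differentiable.continuous
    exact h.integral_comp (g := fun z => ‖f z‖ ^ 2) (by fun_prop)

theorem weightedConjugation_apply {a b c : ℂ} (h : IsConjugationParam a b c) (f : FockSpace)
    (z : ℂ) : (weightedConjugation h).toLinearMap f z
      = c * exp (b * z) * conj (f (conj (a * z + b))) := rfl

/-- The differential expression `∑ j ≤ κ, ψ j * f⁽ʲ⁾`. -/
noncomputable def diffExpr {κ : ℕ} (ψ : Fin (κ + 1) → ℂ → ℂ) (f : ℂ → ℂ) (z : ℂ) : ℂ :=
  ∑ j : Fin (κ + 1), ψ j z * iteratedDeriv j f z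

theorem diffExpr_add {κ : ℕ} (ψ : Fin (κ + 1) → ℂ → ℂ) (f g : FockSpace) (z : ℂ) :
    diffExpr ψ (f + g : FockSpace) z = diffExpr ψ f z + diffExpr ψ g z := by
  unfold diffExpr
  rw [← Finset.sum_add_distrib]
  refine Finset.sum_congr rfl fun j _ => ?_
  have : ((f + g : FockSpace) : ℂ → ℂ) = f + g := rfl
  rw [this, iteratedDeriv_add f.differentiable.contDiff.contDiffAt
    g.differentiable.contDiff.contDiffAt, mul_add]

theorem diffExpr_smul {κ : ℕ} (ψ : Fin (κ + 1) → ℂ → ℂ) (r : ℂ) (f : FockSpace) (z : ℂ) :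
    diffExpr ψ (r • f : FockSpace) z = r * diffExpr ψ f z := by
  unfold diffExpr
  rw [Finset.mul_sum]
  refine Finset.sum_congr rfl fun j _ => ?_
  have : ((r • f : FockSpace) : ℂ → ℂ) = r • (f : ℂ → ℂ) := rfl
  rw [this, iteratedDeriv_const_smul_field, smul_eq_mul]
  ring

/-- The maximal differential operator: `f ↦ ∑ j ≤ κ, ψ j * f⁽ʲ⁾` on the domain of all `f` in the
Fock space for which the result lies in the Fock space. -/
noncomputable def maximalOperator {κ : ℕ} (ψ : Fin (κ + 1) → ℂ → ℂ) :
    FockSpace →ₗ.[ℂ] FockSpace where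
  domain :=
    { carrier := {f | ∃ g : FockSpace, ∀ z, g z = diffExpr ψ f z}
      zero_mem' := ⟨0, fun z => by simpa using (diffExpr_smul ψ 0 0 z).symm⟩
      add_mem' := by
        rintro f₁ f₂ ⟨g₁, h₁⟩ ⟨g₂, h₂⟩
        exact ⟨g₁ + g₂, fun z => by rw [diffExpr_add, ← h₁, ← h₂, FockSpace.add_apply]⟩
      smul_mem' := by
        rintro r f ⟨g, h⟩
        exact ⟨r • g, fun z => by rw [diffExpr_smul, ← h, FockSpace.smul_apply]⟩ }
  toFun :=
    { toFun := fun f => f.2.choose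
      map_add' := fun f g => by
        ext z
        rw [FockSpace.add_apply, f.2.choose_spec, g.2.choose_spec, (f + g).2.choose_spec]
        exact diffExpr_add ψ f g z
      map_smul' := fun r f => by
        ext z
        rw [RingHom.id_apply, FockSpace.smul_apply, f.2.choose_spec, (r • f).2.choose_spec]
        exact diffExpr_smul ψ r f z }

theorem maximalOperator_apply {κ : ℕ} (ψ : Fin (κ + 1) → ℂ → ℂ)
    (f : (maximalOperator ψ).domain) (z : ℂ) :
    maximalOperator ψ f z = diffExpr ψ (f : FockSpace) z :=
  f.2.choose_spec z

/-!
Let `k_w` be the reproducing kernel at `w`. If `T ≤ T_max` is densely defined, then `k_w` lies in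
the domain of `T*`, so `C`-selfadjointness puts `C k_w` in the domain of `T`. Evaluating
`T C k_w = C T* k_w` at `x` gives `ψ₀ w + ψ₁ w (a x + b) = ψ₀ x + ψ₁ x (a w + b)`, an identity
which forces both coefficients to be affine with `d₁₀ = d₀₁`.

For affine coefficients `T_max` is a tridiagonal matrix in the basis `z ^ n / √n!`, with entries off
the diagonal of order `√n`. Since `∑ 1 / √n` diverges, the boundary term in Green's formula tends to
`0`, as in Carleman's criterion. Hence the adjoint of `T_max` is the maximal operator of the formal
adjoint expression, and conjugating it by `C` gives back `T_max`. A `C`-selfadjoint operator has no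
proper `C`-selfadjoint extension, so `T = T_max`.

An eigenvalue is read off from the order of vanishing of an eigenfunction at the zero of `ψ₁`. If
`ψ₁` is a nonzero constant, solving the eigenvalue equation gives a multiple of the exponential of a
quadratic polynomial with leading coefficient `-a / 2`. Along some ray it grows at least like
`exp (|z| ^ 2 / 2)`, whereas `f z = o(exp (|z| ^ 2 / 2))` for every `f` in the Fock space.
-/

section Growth

theorem integrable_exp_mul_sq_norm_fockMeasure {s : ℝ} (hs : s < 1) :
    Integrable (fun z => Real.exp (s * ‖z‖ ^ 2)) fockMeasure := by
  have hgauss := (GaussianFourier.integrable_cexp_neg_mul_sq_norm_add (V := ℂ)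
    (b := ((1 - s : ℝ) : ℂ)) (by simpa using hs) 0 0).norm.const_mul Real.pi⁻¹
  rw [integrable_fockMeasure_iff]
  refine hgauss.congr (Eventually.of_forall fun z => ?_)
  have hexp : -((1 - s : ℝ) : ℂ) * (‖z‖ : ℂ) ^ 2 + 0 * ((inner ℝ (0 : ℂ) z : ℝ) : ℂ)
      = ((-‖z‖ ^ 2 + s * ‖z‖ ^ 2 : ℝ) : ℂ) := by
    push_cast; ring
  simp only [norm_exp, hexp, ofReal_re, Real.exp_add, fockWeight, smul_eq_mul]
  ring

theorem memLp_fockMeasure_of_norm_le {E : Type*} [NormedAddCommGroup E] {f : ℂ → E}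
    (hf : AEStronglyMeasurable f fockMeasure) {C r : ℝ} (hr : r < 1 / 2)
    (hC : ∀ z, ‖f z‖ ≤ C * Real.exp (r * ‖z‖ ^ 2)) : MemLp f 2 fockMeasure := by
  rw [← memLp_norm_iff hf, memLp_two_iff_integrable_sq_norm hf.norm]
  have hint := (integrable_exp_mul_sq_norm_fockMeasure (s := 2 * r) (by linarith)).const_mul (C ^ 2)
  refine hint.mono' (hf.norm.norm.pow 2) (Eventually.of_forall fun z => ?_)
  rw [norm_norm, norm_pow, norm_norm]
  calc ‖f z‖ ^ 2 ≤ (C * Real.exp (r * ‖z‖ ^ 2)) ^ 2 := by gcongr; exact hC z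
    _ = C ^ 2 * Real.exp (2 * r * ‖z‖ ^ 2) := by
      rw [mul_pow, ← Real.exp_nat_mul, Nat.cast_ofNat, mul_assoc]

theorem norm_pow_mul_exp_le (w l : ℂ) (k : ℕ) (z : ℂ) :
    ‖(z - w) ^ k * exp (l * z)‖
      ≤ k.factorial * Real.exp (‖w‖ + (1 + ‖l‖) ^ 2) * Real.exp (1 / 4 * ‖z‖ ^ 2) := by
  have hpow : ‖z - w‖ ^ k ≤ k.factorial * Real.exp (‖z‖ + ‖w‖) := by
    have h := Real.pow_div_factorial_le_exp ‖z - w‖ (norm_nonneg _) k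
    rw [div_le_iff₀' (by positivity)] at h
    exact h.trans (by gcongr; exact norm_sub_le z w)
  have hexp : ‖exp (l * z)‖ ≤ Real.exp (‖l‖ * ‖z‖) := by
    rw [norm_exp, ← norm_mul]
    exact Real.exp_le_exp.2 (re_le_norm _)
  calc ‖(z - w) ^ k * exp (l * z)‖
      ≤ k.factorial * Real.exp (‖z‖ + ‖w‖) * Real.exp (‖l‖ * ‖z‖) := by
        rw [norm_mul, norm_pow]; gcongr
    _ ≤ k.factorial * Real.exp (‖w‖ + (1 + ‖l‖) ^ 2) * Real.exp (1 / 4 * ‖z‖ ^ 2) := by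
        rw [mul_assoc, mul_assoc, ← Real.exp_add, ← Real.exp_add]
        refine mul_le_mul_of_nonneg_left (Real.exp_le_exp.2 ?_) (by positivity)
        nlinarith [sq_nonneg (‖z‖ / 2 - (1 + ‖l‖))]

end Growth

namespace FockSpace

/-- The function `z ↦ (z - w) ^ k * exp (l z)` as an element of the Fock space. Monomials,
reproducing kernels and the eigenfunctions of first order operators are all of this form. -/
noncomputable def powMulExp (w l : ℂ) (k : ℕ) : FockSpace where
  toFun z := (z - w) ^ k * exp (l * z)
  differentiable' := by fun_prop
  memLp' := memLp_fockMeasure_of_norm_le (by fun_prop) (by norm_num) (norm_pow_mul_exp_le w l k)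

theorem powMulExp_apply (w l : ℂ) (k : ℕ) (z : ℂ) :
    powMulExp w l k z = (z - w) ^ k * exp (l * z) := rfl

/-- The monomial `z ↦ z ^ n` as an element of the Fock space. -/
noncomputable def monomial (n : ℕ) : FockSpace := powMulExp 0 0 n

@[simp] theorem monomial_apply (n : ℕ) (z : ℂ) : monomial n z = z ^ n := by
  simp [monomial, powMulExp_apply]

end FockSpace

section Polar

variable {E : Type*} [NormedAddCommGroup E] [NormedSpace ℝ E]

theorem integrableOn_comp_complexPolarCoord_symm {g : ℂ → E} (hg : Integrable g) :
    IntegrableOn (fun p : ℝ × ℝ => p.1 • g (Complex.polarCoord.symm p)) polarCoord.target := by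
  have hprod : Integrable (g ∘ measurableEquivRealProd.symm) :=
    volume_preserving_equiv_real_prod.symm.integrable_comp_of_integrable hg
  have hpull := (integrableOn_image_iff_integrableOn_abs_det_fderiv_smul volume
    polarCoord.open_target.measurableSet
    (fun p _ => (hasFDerivAt_polarCoord_symm p).hasFDerivWithinAt)
    polarCoord.symm.injOn (g ∘ measurableEquivRealProd.symm)).1 hprod.integrableOn
  refine hpull.congr_fun (fun p hp => ?_) polarCoord.open_target.measurableSet
  have hp' : 0 < p.1 := hp.1
  simp only [det_fderivPolarCoordSymm, Function.comp_apply, abs_of_pos hp',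
    measurableEquivRealProd_symm_polarCoord_symm_apply]

theorem integral_eq_integral_Ioi_circleMap {g : ℂ → E} (hg : Integrable g) :
    ∫ z, g z = ∫ r in Set.Ioi (0 : ℝ), r • ∫ t in 0..2 * Real.pi, g (circleMap 0 r t) := by
  have hint := integrableOn_comp_complexPolarCoord_symm hg
  rw [← Complex.integral_comp_polarCoord_symm]
  rw [polarCoord_target, Measure.volume_eq_prod] at hint ⊢
  rw [setIntegral_prod _ hint]
  congr 1 with r
  have hsymm (t : ℝ) : Complex.polarCoord.symm (r, t) = circleMap 0 r t := by
    simp [Complex.polarCoord_symm_apply, circleMap, exp_mul_I]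
  have hper := ((periodic_circleMap 0 r).comp g).intervalIntegral_add_eq (-Real.pi) 0
  rw [show -Real.pi + 2 * Real.pi = Real.pi by ring, zero_add] at hper
  simp only [hsymm, integral_smul]
  rw [← integral_Ioc_eq_integral_Ioo,
    ← intervalIntegral.integral_of_le (by linarith [Real.pi_pos])]
  exact congrArg _ hper

theorem integral_circle_conj_pow_mul {f : ℂ → ℂ} (hf : Differentiable ℂ f) (n : ℕ) {r : ℝ}
    (hr : 0 < r) :
    ∫ t in 0..2 * Real.pi, conj (circleMap 0 r t) ^ n * f (circleMap 0 r t)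
      = 2 * Real.pi * (r : ℂ) ^ (2 * n) / n.factorial * iteratedDeriv n f 0 := by
  have hcauchy := hf.differentiableOn.circleIntegral_one_div_sub_center_pow_smul (c := 0) hr n
  -- On the circle of radius `r` one has `1 / z ^ n = conj z ^ n / r ^ (2 * n)`.
  have hintegrand (t : ℝ) : deriv (circleMap 0 r) t •
      ((1 / (circleMap 0 r t - 0) ^ (n + 1)) • f (circleMap 0 r t))
        = I / (r : ℂ) ^ (2 * n) * (conj (circleMap 0 r t) ^ n * f (circleMap 0 r t)) := by
    have hne : circleMap 0 r t ≠ 0 := circleMap_ne_center hr.ne'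
    have hpow : (r : ℂ) ^ (2 * n) = circleMap 0 r t ^ n * conj (circleMap 0 r t) ^ n := by
      rw [← mul_pow, mul_conj', norm_circleMap_zero, abs_of_pos hr, pow_mul]
    have hne' : conj (circleMap 0 r t) ≠ 0 := by simpa using hne
    rw [deriv_circleMap, hpow]
    simp only [smul_eq_mul, sub_zero]
    field_simp
    ring
  simp only [circleIntegral, hintegrand] at hcauchy
  simp only [intervalIntegral.integral_const_mul, smul_eq_mul] at hcauchy
  have hr' : (r : ℂ) ≠ 0 := ofReal_ne_zero.2 hr.ne'
  have hfac : (n.factorial : ℂ) ≠ 0 := by exact_mod_cast n.factorial_ne_zero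
  field_simp at hcauchy ⊢
  linear_combination hcauchy

end Polar

namespace FockSpace

theorem integral_circle_fockWeight_smul_conj_monomial_mul (n : ℕ) (f : FockSpace) {r : ℝ}
    (hr : 0 < r) :
    r • ∫ t in 0..2 * Real.pi, fockWeight (circleMap 0 r t) •
        (conj (monomial n (circleMap 0 r t)) * f (circleMap 0 r t))
      = ((r ^ ((2 * n + 1 : ℕ) : ℝ) * Real.exp (-r ^ (2 : ℝ)) : ℝ) : ℂ)
        * (2 / n.factorial * iteratedDeriv n f 0) := by
  have hweight (t : ℝ) : fockWeight (circleMap 0 r t) = Real.exp (-r ^ 2) / Real.pi := by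
    rw [fockWeight, norm_circleMap_zero, sq_abs]
  have hpi : (Real.pi : ℂ) ≠ 0 := ofReal_ne_zero.2 Real.pi_ne_zero
  simp only [hweight, monomial_apply, map_pow, intervalIntegral.integral_smul,
    integral_circle_conj_pow_mul f.differentiable n hr, Real.rpow_natCast, Real.rpow_ofNat]
  simp only [real_smul]
  push_cast
  field_simp
  ring

theorem inner_monomial (n : ℕ) (f : FockSpace) :
    inner ℂ (monomial n) f = iteratedDeriv n f 0 := by
  have hint := (integrable_fockMeasure_iff _).1 (integrable_conj_mul (monomial n) f)
  have hradial : ∫ r in Set.Ioi (0 : ℝ), r ^ ((2 * n + 1 : ℕ) : ℝ) * Real.exp (-r ^ (2 : ℝ))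
      = n.factorial / 2 := by
    rw [_root_.integral_rpow_mul_exp_neg_rpow two_pos
        (neg_one_lt_zero.trans_le (Nat.cast_nonneg _)),
      show (((2 * n + 1 : ℕ) : ℝ) + 1) / 2 = n + 1 by push_cast; ring,
      Real.Gamma_nat_eq_factorial]
    ring
  have hfac : (n.factorial : ℂ) ≠ 0 := by exact_mod_cast n.factorial_ne_zero
  rw [inner_def, integral_fockMeasure, integral_eq_integral_Ioi_circleMap hint,
    setIntegral_congr_fun measurableSet_Ioi fun r hr =>
      integral_circle_fockWeight_smul_conj_monomial_mul n f hr,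
    integral_mul_const, integral_complex_ofReal, hradial]
  push_cast
  field_simp

end FockSpace

theorem ofReal_sqrt_factorial_ne_zero (n : ℕ) : (√(n.factorial : ℝ) : ℂ) ≠ 0 :=
  ofReal_ne_zero.2 (Real.sqrt_pos.2 (Nat.cast_pos.2 n.factorial_pos)).ne'

theorem ofReal_sqrt_factorial_mul_self (n : ℕ) :
    (√(n.factorial : ℝ) : ℂ) * √(n.factorial : ℝ) = n.factorial := by
  rw [← ofReal_mul, Real.mul_self_sqrt (Nat.cast_nonneg _), ofReal_natCast]

namespace FockSpace

/-- The monomial of degree `n` divided by its norm `√n!`. -/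
noncomputable def normalizedMonomial (n : ℕ) : FockSpace :=
  (√(n.factorial : ℝ) : ℂ)⁻¹ • monomial n

theorem inner_normalizedMonomial (n : ℕ) (f : FockSpace) :
    inner ℂ (normalizedMonomial n) f = iteratedDeriv n f 0 / √(n.factorial : ℝ) := by
  rw [normalizedMonomial, inner_smul_left, inner_monomial, map_inv₀, conj_ofReal, inv_mul_eq_div]

theorem iteratedDeriv_eq_sqrt_factorial_mul_inner (n : ℕ) (f : FockSpace) :
    iteratedDeriv n f 0 = √(n.factorial : ℝ) * inner ℂ (normalizedMonomial n) f := by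
  rw [inner_normalizedMonomial, mul_div_cancel₀ _ (ofReal_sqrt_factorial_ne_zero n)]

theorem orthonormal_normalizedMonomial : Orthonormal ℂ normalizedMonomial := by
  rw [orthonormal_iff_ite]
  intro m n
  have hcoe : (monomial n : ℂ → ℂ) = fun z => z ^ n := funext (monomial_apply n)
  rw [inner_normalizedMonomial, normalizedMonomial, ← inner_monomial, inner_smul_right,
    inner_monomial, hcoe, iteratedDeriv_fun_pow_zero]
  split_ifs with h
  · subst h
    have hne := ofReal_sqrt_factorial_ne_zero m
    rw [← ofReal_sqrt_factorial_mul_self]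
    field_simp
  · simp

theorem eq_zero_of_forall_inner_normalizedMonomial {f : FockSpace}
    (h : ∀ n, inner ℂ (normalizedMonomial n) f = 0) : f = 0 := by
  ext z
  have htaylor := hasSum_taylorSeries_of_entire f.differentiable 0 z
  simp only [iteratedDeriv_eq_sqrt_factorial_mul_inner, h, mul_zero, smul_zero] at htaylor
  exact htaylor.unique hasSum_zero

/-- The normalized monomials as a Hilbert basis of the Fock space. -/
noncomputable def monomialBasis : HilbertBasis ℕ ℂ FockSpace :=
  HilbertBasis.mkOfOrthogonalEqBot orthonormal_normalizedMonomial <|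
    (Submodule.eq_bot_iff _).2 fun _ hf => eq_zero_of_forall_inner_normalizedMonomial fun n =>
      (Submodule.mem_orthogonal _ _).1 hf _ (Submodule.subset_span ⟨n, rfl⟩)

theorem hasSum_conj_inner_mul_inner (g f : FockSpace) :
    HasSum (fun n => conj (inner ℂ (normalizedMonomial n) g) * inner ℂ (normalizedMonomial n) f)
      (inner ℂ g f) := by
  simpa only [monomialBasis, HilbertBasis.coe_mkOfOrthogonalEqBot, inner_conj_symm]
    using monomialBasis.hasSum_inner_mul_inner g f

theorem hasSum_inner (g f : FockSpace) :
    HasSum (fun n => conj (iteratedDeriv n g 0) * iteratedDeriv n f 0 / (n.factorial : ℂ))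
      (inner ℂ g f) := by
  refine (hasSum_conj_inner_mul_inner g f).congr_fun fun n => ?_
  have hne := ofReal_sqrt_factorial_ne_zero n
  rw [inner_normalizedMonomial, inner_normalizedMonomial, map_div₀, conj_ofReal,
    ← ofReal_sqrt_factorial_mul_self]
  field_simp

end FockSpace

theorem iteratedDeriv_id_mul {𝕜 : Type*} [NontriviallyNormedField 𝕜] {n : ℕ} {f : 𝕜 → 𝕜} {x : 𝕜}
    (hf : ContDiffAt 𝕜 n f x) :
    iteratedDeriv n (fun z => z * f z) x
      = x * iteratedDeriv n f x + n * iteratedDeriv (n - 1) f x := by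
  rw [iteratedDeriv_fun_mul (f := fun z => z) contDiffAt_id hf]
  cases n with
  | zero => simp
  | succ n =>
    rw [Finset.sum_range_succ', Finset.sum_range_succ']
    simp [iteratedDeriv_fun_id, add_comm]

namespace FockSpace

/-- The reproducing kernel `z ↦ exp (conj w * z)` of the Fock space. -/
noncomputable def kernel (w : ℂ) : FockSpace := powMulExp 0 (conj w) 0

/-- The function `z ↦ z * exp (conj w * z)`, which represents the functional `f ↦ deriv f w`. -/
noncomputable def derivKernel (w : ℂ) : FockSpace := powMulExp 0 (conj w) 1

theorem kernel_apply (w z : ℂ) : kernel w z = exp (conj w * z) := by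
  simp [kernel, powMulExp_apply]

theorem derivKernel_apply (w z : ℂ) : derivKernel w z = z * exp (conj w * z) := by
  simp [derivKernel, powMulExp_apply]

theorem iteratedDeriv_kernel (w : ℂ) (n : ℕ) : iteratedDeriv n (kernel w) 0 = conj w ^ n := by
  rw [show (kernel w : ℂ → ℂ) = fun z => exp (conj w * z) from funext (kernel_apply w),
    iteratedDeriv_cexp_const_mul]
  simp

theorem iteratedDeriv_derivKernel (w : ℂ) (n : ℕ) :
    iteratedDeriv n (derivKernel w) 0 = n * conj w ^ (n - 1) := by
  have hcoe : (derivKernel w : ℂ → ℂ) = fun z => z * kernel w z :=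
    funext fun z => by rw [derivKernel_apply, kernel_apply]
  rw [hcoe, iteratedDeriv_id_mul (kernel w).differentiable.contDiff.contDiffAt, zero_mul, zero_add,
    iteratedDeriv_kernel]

theorem deriv_kernel (w z : ℂ) : deriv (kernel w) z = conj w * kernel w z := by
  have hfun : (kernel w : ℂ → ℂ) = fun x => exp (conj w * x) := funext (kernel_apply w)
  have hderiv : HasDerivAt (fun x => exp (conj w * x)) (exp (conj w * z) * (conj w * 1)) z :=
    ((hasDerivAt_id z).const_mul (conj w)).cexp
  rw [kernel_apply, hfun, hderiv.deriv]
  ring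

theorem inner_kernel (w : ℂ) (f : FockSpace) : inner ℂ (kernel w) f = f w := by
  refine (hasSum_inner (kernel w) f).unique
    ((hasSum_taylorSeries_of_entire f.differentiable 0 w).congr_fun fun n => ?_)
  rw [iteratedDeriv_kernel, map_pow, conj_conj, sub_zero, smul_eq_mul, smul_eq_mul]
  field_simp

theorem inner_derivKernel (w : ℂ) (f : FockSpace) :
    inner ℂ (derivKernel w) f = deriv f w := by
  have htaylor := hasSum_taylorSeries_of_entire
    (f.differentiable.contDiff.differentiable_deriv_two) 0 w
  refine (hasSum_inner (derivKernel w) f).unique ?_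
  rw [← hasSum_nat_add_iff' 1]
  simp only [Finset.sum_range_one, iteratedDeriv_derivKernel, Nat.cast_zero, zero_mul, map_zero,
    zero_div, sub_zero]
  refine htaylor.congr_fun fun n => ?_
  have hfac : (n.factorial : ℂ) ≠ 0 := by exact_mod_cast n.factorial_ne_zero
  have hsucc : ((n : ℂ) + 1) ≠ 0 := by exact_mod_cast n.succ_ne_zero
  simp only [iteratedDeriv_succ', Nat.add_sub_cancel, map_mul, map_pow, conj_conj, map_natCast,
    Nat.factorial_succ, smul_eq_mul, sub_zero]
  push_cast
  field_simp

theorem continuous_apply (w : ℂ) : Continuous fun f : FockSpace => f w := by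
  simp only [← inner_kernel]
  fun_prop

theorem continuous_deriv_apply (w : ℂ) : Continuous fun f : FockSpace => deriv f w := by
  simp only [← inner_derivKernel]
  fun_prop

theorem norm_kernel (w : ℂ) : ‖kernel w‖ = Real.exp (‖w‖ ^ 2 / 2) := by
  have hsq : ‖kernel w‖ ^ 2 = Real.exp (‖w‖ ^ 2) := by
    rw [← inner_self_eq_norm_sq (𝕜 := ℂ), inner_kernel, kernel_apply, conj_mul', ← ofReal_pow,
      ← ofReal_exp]
    exact ofReal_re _
  rw [← sq_eq_sq₀ (norm_nonneg _) (Real.exp_pos _).le, hsq, ← Real.exp_nat_mul]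
  congr 1
  push_cast
  ring

theorem norm_apply_le_exp_mul_norm (f : FockSpace) (w : ℂ) :
    ‖f w‖ ≤ Real.exp (‖w‖ ^ 2 / 2) * ‖f‖ := by
  rw [← inner_kernel, ← norm_kernel]
  exact norm_inner_le_norm _ _

theorem dense_span_range_kernel :
    Dense (Submodule.span ℂ (Set.range kernel) : Set FockSpace) := by
  rw [Submodule.dense_iff_topologicalClosure_eq_top,
    Submodule.topologicalClosure_eq_top_iff, Submodule.eq_bot_iff]
  refine fun f hf => ext fun w => ?_
  rw [← inner_kernel]
  exact (Submodule.mem_orthogonal _ _).1 hf _ (Submodule.subset_span ⟨w, rfl⟩)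

end FockSpace

section Jacobi

/-- A sequence `s` converging to a nonzero limit and bounded by `a n * y n` with `y` summable would
make `(a n)⁻¹` summable; this is the mechanism of Carleman's criterion for Jacobi matrices. -/
theorem eq_zero_of_tendsto_of_norm_le_mul {E : Type*} [NormedAddCommGroup E] {s : ℕ → E} {L : E}
    (hs : Tendsto s atTop (𝓝 L)) {a y : ℕ → ℝ} (ha : ∀ n, 0 ≤ a n)
    (ha' : ¬Summable fun n => (a n)⁻¹) (hy : Summable y) (h : ∀ n, ‖s n‖ ≤ a n * y n) :
    L = 0 := by
  by_contra hL
  have hL' : 0 < ‖L‖ := norm_pos_iff.2 hL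
  refine ha' (Summable.of_norm_bounded_eventually_nat (hy.mul_left (2 / ‖L‖)) ?_)
  filter_upwards [hs.norm.eventually (lt_mem_nhds (half_lt_self hL'))] with n hn
  have hlt : ‖L‖ / 2 < a n * y n := hn.trans_le (h n)
  have hpos : 0 < a n := (ha n).lt_of_ne fun h0 => by
    rw [← h0, zero_mul] at hlt
    linarith
  rw [Real.norm_of_nonneg (inv_nonneg.2 (ha n)), inv_le_iff_one_le_mul₀' hpos]
  calc (1 : ℝ) = 2 / ‖L‖ * (‖L‖ / 2) := by field_simp
    _ ≤ 2 / ‖L‖ * (a n * y n) := by gcongr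
    _ = a n * (2 / ‖L‖ * y n) := by ring

theorem not_summable_inv_sqrt_natCast : ¬Summable fun n : ℕ => (√(n : ℝ))⁻¹ := by
  simp only [Real.sqrt_eq_rpow, Real.summable_nat_rpow_inv]
  norm_num

/-- The tridiagonal matrix of `f ↦ (α + β z) f + (γ + δ z) deriv f` in the basis of normalized
monomials, acting on coefficient sequences. The index `n - 1` at `n = 0` is harmless because its
coefficient `√n` vanishes there. -/
noncomputable def jacobi (α β γ δ : ℂ) (u : ℕ → ℂ) (n : ℕ) : ℂ :=
  (α + δ * n) * u n + β * √(n : ℝ) * u (n - 1) + γ * √((n + 1 : ℕ) : ℝ) * u (n + 1)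

/-- The boundary term in Green's formula for `jacobi`. -/
noncomputable def jacobiBoundary (β γ : ℂ) (v u : ℕ → ℂ) (n : ℕ) : ℂ :=
  √(n : ℝ) * (β * (conj (v n) * u (n - 1)) - γ * (conj (v (n - 1)) * u n))

theorem sum_range_jacobi_sub (α β γ δ : ℂ) (v u : ℕ → ℂ) (N : ℕ) :
    ∑ n ∈ Finset.range N, (conj (jacobi (conj α) (conj γ) (conj β) (conj δ) v n) * u n
        - conj (v n) * jacobi α β γ δ u n) = jacobiBoundary β γ v u N := by
  have hdiff (n : ℕ) : conj (jacobi (conj α) (conj γ) (conj β) (conj δ) v n) * u n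
        - conj (v n) * jacobi α β γ δ u n
      = jacobiBoundary β γ v u (n + 1) - jacobiBoundary β γ v u n := by
    simp only [jacobi, jacobiBoundary, map_add, map_mul, conj_conj, conj_ofReal, map_natCast,
      Nat.add_sub_cancel]
    ring
  simp only [hdiff, Finset.sum_range_sub]
  simp [jacobiBoundary]

theorem norm_jacobiBoundary_le (β γ : ℂ) (v u : ℕ → ℂ) (n : ℕ) :
    ‖jacobiBoundary β γ v u n‖ ≤ √(n : ℝ) *
      (‖β‖ * (‖v n‖ ^ 2 + ‖u (n - 1)‖ ^ 2) + ‖γ‖ * (‖v (n - 1)‖ ^ 2 + ‖u n‖ ^ 2)) := by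
  have hmul (x y : ℂ) : ‖conj x * y‖ ≤ ‖x‖ ^ 2 + ‖y‖ ^ 2 := by
    rw [norm_mul, RCLike.norm_conj]
    nlinarith [two_mul_le_add_sq ‖x‖ ‖y‖, norm_nonneg x, norm_nonneg y]
  rw [jacobiBoundary, norm_mul, norm_real, Real.norm_of_nonneg (Real.sqrt_nonneg _)]
  gcongr
  refine (norm_sub_le _ _).trans ?_
  rw [norm_mul β, norm_mul γ]
  gcongr <;> exact hmul _ _

theorem summable_natSub_one {u : ℕ → ℝ} (hu : Summable u) : Summable fun n => u (n - 1) :=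
  (summable_nat_add_iff 1).1 (by simpa using hu)

theorem jacobi_hasSum_unique {α β γ δ : ℂ} {v u : ℕ → ℂ} (hv : Summable fun n => ‖v n‖ ^ 2)
    (hu : Summable fun n => ‖u n‖ ^ 2) {S S' : ℂ}
    (hS : HasSum (fun n => conj (jacobi (conj α) (conj γ) (conj β) (conj δ) v n) * u n) S)
    (hS' : HasSum (fun n => conj (v n) * jacobi α β γ δ u n) S') : S = S' := by
  have hlim := (hS.sub hS').tendsto_sum_nat
  simp only [sum_range_jacobi_sub] at hlim
  refine sub_eq_zero.1 (eq_zero_of_tendsto_of_norm_le_mul hlim (fun n => Real.sqrt_nonneg _)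
    not_summable_inv_sqrt_natCast ?_ (norm_jacobiBoundary_le β γ v u))
  exact ((hv.add (summable_natSub_one hu)).mul_left _).add
    (((summable_natSub_one hv).add hu).mul_left _)

end Jacobi

theorem iteratedDeriv_mul_add_mul_deriv (α γ : ℂ) (n : ℕ) {f : ℂ → ℂ} (hf : Differentiable ℂ f)
    (x : ℂ) :
    iteratedDeriv n (fun z => α * f z + γ * deriv f z) x
      = α * iteratedDeriv n f x + γ * iteratedDeriv (n + 1) f x := by
  have hd : Differentiable ℂ (deriv f) := hf.contDiff.differentiable_deriv_two
  rw [iteratedDeriv_fun_add (hf.const_mul α).contDiff.contDiffAt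
    (hd.const_mul γ).contDiff.contDiffAt, iteratedDeriv_const_mul_field,
    iteratedDeriv_const_mul_field, iteratedDeriv_succ']

theorem iteratedDeriv_affine_zero (α β γ δ : ℂ) (n : ℕ) {f : ℂ → ℂ} (hf : Differentiable ℂ f) :
    iteratedDeriv n (fun z => (α + β * z) * f z + (γ + δ * z) * deriv f z) 0
      = (α + δ * n) * iteratedDeriv n f 0 + β * (n * iteratedDeriv (n - 1) f 0)
        + γ * iteratedDeriv (n + 1) f 0 := by
  have hd : Differentiable ℂ (deriv f) := hf.contDiff.differentiable_deriv_two
  have hlin (p q : ℂ) : Differentiable ℂ fun z => p * f z + q * deriv f z :=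
    (hf.const_mul p).add (hd.const_mul q)
  have hmul : Differentiable ℂ fun z => z * (β * f z + δ * deriv f z) :=
    differentiable_id.mul (hlin β δ)
  have hsplit : (fun z => (α + β * z) * f z + (γ + δ * z) * deriv f z)
      = fun z => (α * f z + γ * deriv f z) + z * (β * f z + δ * deriv f z) := by
    funext z; ring
  have hpred : (n : ℂ) * iteratedDeriv (n - 1 + 1) f 0 = n * iteratedDeriv n f 0 := by
    cases n <;> simp
  rw [hsplit, iteratedDeriv_fun_add (hlin α γ).contDiff.contDiffAt
    hmul.contDiff.contDiffAt,
    iteratedDeriv_id_mul (hlin β δ).contDiff.contDiffAt, iteratedDeriv_mul_add_mul_deriv α γ n hf,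
    iteratedDeriv_mul_add_mul_deriv β δ (n - 1) hf]
  linear_combination δ * hpred

namespace FockSpace

theorem inner_normalizedMonomial_affine {α β γ δ : ℂ} {f h : FockSpace}
    (hh : ∀ z, h z = (α + β * z) * f z + (γ + δ * z) * deriv f z) (n : ℕ) :
    inner ℂ (normalizedMonomial n) h
      = jacobi α β γ δ (fun n => inner ℂ (normalizedMonomial n) f) n := by
  have hsucc (k : ℕ) : (√((k + 1).factorial : ℝ) : ℂ)
      = √((k + 1 : ℕ) : ℝ) * √(k.factorial : ℝ) := by
    rw [Nat.factorial_succ, Nat.cast_mul, Real.sqrt_mul (Nat.cast_nonneg _), ofReal_mul]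
  have hpred : (n : ℂ) * √((n - 1).factorial : ℝ) = √(n : ℝ) * √(n.factorial : ℝ) := by
    cases n with
    | zero => simp
    | succ k =>
      rw [hsucc, Nat.add_sub_cancel, ← mul_assoc, ← ofReal_mul,
        Real.mul_self_sqrt (Nat.cast_nonneg _), ofReal_natCast]
  have hne := ofReal_sqrt_factorial_ne_zero n
  rw [inner_normalizedMonomial, show (h : ℂ → ℂ) = _ from funext hh,
    iteratedDeriv_affine_zero α β γ δ n f.differentiable, div_eq_iff hne, jacobi]
  simp only [iteratedDeriv_eq_sqrt_factorial_mul_inner]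
  rw [hsucc]
  linear_combination β * inner ℂ (normalizedMonomial (n - 1)) f * hpred

theorem inner_eq_inner_of_affine {α β γ δ : ℂ} {f g hf hg : FockSpace}
    (h : ∀ z, hf z = (α + β * z) * f z + (γ + δ * z) * deriv f z)
    (h' : ∀ z, hg z = (conj α + conj γ * z) * g z + (conj β + conj δ * z) * deriv g z) :
    inner ℂ hg f = inner ℂ g hf := by
  have hsum := hasSum_conj_inner_mul_inner hg f
  have hsum' := hasSum_conj_inner_mul_inner g hf
  simp only [inner_normalizedMonomial_affine h'] at hsum
  simp only [inner_normalizedMonomial_affine h] at hsum'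
  exact jacobi_hasSum_unique (orthonormal_normalizedMonomial.inner_products_summable g)
    (orthonormal_normalizedMonomial.inner_products_summable f) hsum hsum'

end FockSpace

section ConjugateGraph

variable {H : Type*} [NormedAddCommGroup H] [InnerProductSpace ℂ H]

theorem mem_graph_adjoint_iff_forall_inner_eq {𝕜 E F : Type*} [RCLike 𝕜]
    [NormedAddCommGroup E] [InnerProductSpace 𝕜 E] [CompleteSpace E]
    [NormedAddCommGroup F] [InnerProductSpace 𝕜 F] {T : E →ₗ.[𝕜] F}
    (hT : Dense (T.domain : Set E)) {y : F} {w : E} :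
    (y, w) ∈ T.adjoint.graph ↔ ∀ x u, (x, u) ∈ T.graph → inner 𝕜 u y = inner 𝕜 x w := by
  simp only [LinearPMap.adjoint_graph_eq_graph_adjoint hT, Submodule.mem_adjoint_iff, sub_eq_zero]

namespace Conjugation

theorem apply_apply (C : Conjugation H) (x : H) : C.toLinearMap (C.toLinearMap x) = x :=
  C.involutive' x

theorem mem_graph_conjugate_iff (C : Conjugation H) (A : H →ₗ.[ℂ] H) {f g : H} :
    (f, g) ∈ (C.conjugate A).graph ↔ (C.toLinearMap f, C.toLinearMap g) ∈ A.graph := by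
  simp only [LinearPMap.mem_graph_iff]
  constructor
  · rintro ⟨f', rfl, rfl⟩
    exact ⟨⟨C.toLinearMap f', f'.2⟩, rfl, (C.apply_apply _).symm⟩
  · rintro ⟨⟨_, hf⟩, rfl, hg⟩
    refine ⟨⟨f, hf⟩, rfl, ?_⟩
    rw [← C.apply_apply g, ← hg]
    rfl

end Conjugation

theorem IsCSelfadjoint.eq_of_le [CompleteSpace H] {C : Conjugation H} {S T : H →ₗ.[ℂ] H}
    (hS : IsCSelfadjoint C S) (hT : IsCSelfadjoint C T) (hST : S ≤ T) : S = T := by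
  refine le_antisymm hST (LinearPMap.le_of_le_graph ?_)
  rintro ⟨f, g⟩ hfg
  rw [hT.2.2, C.mem_graph_conjugate_iff, mem_graph_adjoint_iff_forall_inner_eq hT.2.1] at hfg
  rw [hS.2.2, C.mem_graph_conjugate_iff, mem_graph_adjoint_iff_forall_inner_eq hS.2.1]
  exact fun x u hx => hfg x u (LinearPMap.le_graph_of_le hST hx)

end ConjugateGraph

section MaximalOperator

variable {ψ₀ ψ₁ : ℂ → ℂ}

theorem diffExpr_pair (ψ₀ ψ₁ f : ℂ → ℂ) (z : ℂ) :
    diffExpr ![ψ₀, ψ₁] f z = ψ₀ z * f z + ψ₁ z * deriv f z := by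
  simp [diffExpr, Fin.sum_univ_two]

theorem mem_graph_maximalOperator_iff {f g : FockSpace} :
    (f, g) ∈ (maximalOperator ![ψ₀, ψ₁]).graph ↔
      ∀ z, g z = ψ₀ z * f z + ψ₁ z * deriv f z := by
  simp only [LinearPMap.mem_graph_iff, ← diffExpr_pair]
  constructor
  · rintro ⟨f', rfl, rfl⟩ z
    exact maximalOperator_apply _ f' z
  · intro h
    refine ⟨⟨f, g, h⟩, rfl, FockSpace.ext fun z => ?_⟩
    rw [maximalOperator_apply, h]

theorem isClosed_maximalOperator (ψ₀ ψ₁ : ℂ → ℂ) :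
    (maximalOperator ![ψ₀, ψ₁]).IsClosed := by
  have hgraph : ((maximalOperator ![ψ₀, ψ₁]).graph : Set (FockSpace × FockSpace))
      = ⋂ z, {p | p.2 z = ψ₀ z * p.1 z + ψ₁ z * deriv p.1 z} := by
    ext ⟨f, g⟩
    simp only [SetLike.mem_coe, mem_graph_maximalOperator_iff, Set.mem_iInter, Set.mem_ofPred_eq]
  rw [LinearPMap.IsClosed, hgraph]
  refine isClosed_iInter fun z =>
    isClosed_eq ((FockSpace.continuous_apply z).comp continuous_snd) ?_
  exact (continuous_const.mul ((FockSpace.continuous_apply z).comp continuous_fst)).add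
    (continuous_const.mul ((FockSpace.continuous_deriv_apply z).comp continuous_fst))

theorem mem_pointSpectrum_maximalOperator_iff {μ : ℂ} :
    μ ∈ pointSpectrum (maximalOperator ![ψ₀, ψ₁]) ↔
      ∃ f : FockSpace, f ≠ 0 ∧ ∀ z, μ * f z = ψ₀ z * f z + ψ₁ z * deriv f z := by
  have key (f : FockSpace) : (∀ z, μ * f z = ψ₀ z * f z + ψ₁ z * deriv f z) ↔
      (f, μ • f) ∈ (maximalOperator ![ψ₀, ψ₁]).graph := by
    rw [mem_graph_maximalOperator_iff]
    rfl
  simp only [key, LinearPMap.mem_graph_iff]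
  constructor
  · rintro ⟨f, hf, hμ⟩
    exact ⟨f, hf, f, rfl, hμ⟩
  · rintro ⟨_, hf, f, rfl, hμ⟩
    exact ⟨f, hf, hμ⟩

end MaximalOperator

section Affine

variable (p₀ p₁ q₀ q₁ : ℂ)

theorem kernel_mem_graph_maximalOperator_affine (w : ℂ) :
    (FockSpace.kernel w, (p₀ + q₀ * conj w) • FockSpace.kernel w
      + (p₁ + q₁ * conj w) • FockSpace.derivKernel w)
      ∈ (maximalOperator ![fun z => p₀ + p₁ * z, fun z => q₀ + q₁ * z]).graph := by
  rw [mem_graph_maximalOperator_iff]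
  intro z
  rw [FockSpace.deriv_kernel, FockSpace.add_apply, FockSpace.smul_apply, FockSpace.smul_apply,
    FockSpace.kernel_apply, FockSpace.derivKernel_apply]
  ring

theorem dense_domain_maximalOperator_affine :
    Dense ((maximalOperator ![fun z => p₀ + p₁ * z, fun z => q₀ + q₁ * z]).domain :
      Set FockSpace) :=
  FockSpace.dense_span_range_kernel.mono <| Submodule.span_le.2 <| Set.range_subset_iff.2 fun w =>
    LinearPMap.mem_domain_of_mem_graph (kernel_mem_graph_maximalOperator_affine p₀ p₁ q₀ q₁ w)

theorem adjoint_maximalOperator_affine :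
    (maximalOperator ![fun z => p₀ + p₁ * z, fun z => q₀ + q₁ * z]).adjoint
      = maximalOperator ![fun z => conj p₀ + conj q₀ * z, fun z => conj p₁ + conj q₁ * z] := by
  refine LinearPMap.eq_of_eq_graph (SetLike.ext fun ⟨f, g⟩ => ?_)
  rw [mem_graph_adjoint_iff_forall_inner_eq (dense_domain_maximalOperator_affine p₀ p₁ q₀ q₁),
    mem_graph_maximalOperator_iff]
  constructor
  · intro h z
    have hz := h _ _ (kernel_mem_graph_maximalOperator_affine p₀ p₁ q₀ q₁ z)
    simp only [inner_add_left, inner_smul_left, FockSpace.inner_kernel,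
      FockSpace.inner_derivKernel, map_add, map_mul, conj_conj] at hz
    exact hz.symm
  · intro h x u hx
    rw [← inner_conj_symm, ← inner_conj_symm x,
      FockSpace.inner_eq_inner_of_affine (mem_graph_maximalOperator_iff.1 hx) h]

end Affine

section WeightedConjugation

variable {a b c : ℂ} (h : IsConjugationParam a b c)
include h

theorem IsConjugationParam.a_ne_zero : a ≠ 0 := left_ne_zero_of_mul_eq_one h.a_mul_conj

theorem IsConjugationParam.c_mul_exp_ne_zero (z : ℂ) : c * exp (b * z) ≠ 0 := by
  refine mul_ne_zero ?_ (exp_ne_zero _)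
  rintro rfl
  simpa using h.c_b

theorem deriv_weightedConjugation (f : FockSpace) (z : ℂ) :
    deriv ((weightedConjugation h).toLinearMap f) z
      = c * exp (b * z) * (b * conj (f (conj (a * z + b)))
        + a * conj (deriv f (conj (a * z + b)))) := by
  have hfun : ((weightedConjugation h).toLinearMap f : ℂ → ℂ)
      = fun z => c * exp (b * z) * (conj ∘ f ∘ conj) (a * z + b) :=
    funext (weightedConjugation_apply h f)
  have hconj : HasDerivAt (conj ∘ f ∘ conj) (conj (deriv f (conj (a * z + b)))) (a * z + b) :=
    hasDerivAt_conj_conj_iff.2 (by simpa using (f.differentiable _).hasDerivAt)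
  have haffine : HasDerivAt (fun z => a * z + b) a z := by
    simpa using ((hasDerivAt_id z).const_mul a).add_const b
  have hweight : HasDerivAt (fun z => c * exp (b * z)) (c * (exp (b * z) * (b * 1))) z :=
    (((hasDerivAt_id z).const_mul b).cexp).const_mul c
  have hmul : HasDerivAt (fun z => c * exp (b * z) * (conj ∘ f ∘ conj) (a * z + b)) _ z :=
    hweight.mul (HasDerivAt.comp (h₂ := conj ∘ f ∘ conj) z hconj haffine)
  rw [hfun, hmul.deriv]
  simp only [Function.comp_apply]
  ring

theorem conjugate_maximalOperator (φ₀ φ₁ : ℂ → ℂ) :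
    (weightedConjugation h).conjugate (maximalOperator ![φ₀, φ₁])
      = maximalOperator ![fun z => conj (φ₀ (conj (a * z + b)) + b * φ₁ (conj (a * z + b))),
          fun z => conj (a * φ₁ (conj (a * z + b)))] := by
  refine LinearPMap.eq_of_eq_graph (SetLike.ext fun ⟨f, g⟩ => ?_)
  rw [Conjugation.mem_graph_conjugate_iff, mem_graph_maximalOperator_iff,
    mem_graph_maximalOperator_iff]
  have pointwise (z : ℂ) : (weightedConjugation h).toLinearMap g z
        = φ₀ z * (weightedConjugation h).toLinearMap f z
          + φ₁ z * deriv ((weightedConjugation h).toLinearMap f) z ↔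
      g (conj (a * z + b)) = conj (φ₀ z + b * φ₁ z) * f (conj (a * z + b))
        + conj (a * φ₁ z) * deriv f (conj (a * z + b)) := by
    have hexpr : φ₀ z * (weightedConjugation h).toLinearMap f z
          + φ₁ z * deriv ((weightedConjugation h).toLinearMap f) z
        = c * exp (b * z) * conj (conj (φ₀ z + b * φ₁ z) * f (conj (a * z + b))
          + conj (a * φ₁ z) * deriv f (conj (a * z + b))) := by
      rw [deriv_weightedConjugation, weightedConjugation_apply]
      simp only [map_add, map_mul, conj_conj]
      ring
    rw [hexpr, weightedConjugation_apply, mul_right_inj' (h.c_mul_exp_ne_zero z),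
      (RingHom.injective _).eq_iff]
  simp only [pointwise]
  exact ⟨fun hz z => by simpa only [h.affine_affine] using hz (conj (a * z + b)),
    fun hz z => by simpa only [h.affine_affine] using hz (conj (a * z + b))⟩

theorem isCSelfadjoint_maximalOperator (d₀₀ d₀₁ d₁₁ : ℂ) :
    IsCSelfadjoint (weightedConjugation h)
      (maximalOperator ![fun z => d₀₀ + d₀₁ * (a * z + b), fun z => d₀₁ + d₁₁ * (a * z + b)]) := by
  have hψ₀ : (fun z => d₀₀ + d₀₁ * (a * z + b)) = fun z => (d₀₀ + d₀₁ * b) + d₀₁ * a * z := by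
    funext z; ring
  have hψ₁ : (fun z => d₀₁ + d₁₁ * (a * z + b)) = fun z => (d₀₁ + d₁₁ * b) + d₁₁ * a * z := by
    funext z; ring
  rw [hψ₀, hψ₁]
  refine ⟨isClosed_maximalOperator _ _, dense_domain_maximalOperator_affine _ _ _ _, ?_⟩
  rw [adjoint_maximalOperator_affine, conjugate_maximalOperator]
  congr 3
  · funext z
    simp only [map_add, map_mul, conj_conj]
    linear_combination -(d₀₁ + d₁₁ * (a * z + b)) * h.a_mul_conj_b
  · funext z
    simp only [map_add, map_mul, conj_conj]
    linear_combination -(d₀₁ + d₁₁ * (a * z + b)) * h.a_mul_conj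

end WeightedConjugation

section Necessity

theorem exists_affine_of_symm {X R : Type*} [CommRing R] {θ φ₀ φ₁ : X → R}
    (hθ : Function.Surjective θ) (hsymm : ∀ x y, φ₀ x + φ₁ x * θ y = φ₀ y + φ₁ y * θ x) :
    ∃ d₀₀ d₀₁ d₁₁ : R, φ₀ = (fun x => d₀₀ + d₀₁ * θ x) ∧ φ₁ = fun x => d₀₁ + d₁₁ * θ x := by
  obtain ⟨x₀, hx₀⟩ := hθ 0
  obtain ⟨x₁, hx₁⟩ := hθ 1
  have hφ₀ (x : X) : φ₀ x = φ₀ x₀ + φ₁ x₀ * θ x := by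
    linear_combination hsymm x x₀ - φ₁ x * hx₀
  refine ⟨φ₀ x₀, φ₁ x₀, φ₁ x₁ - φ₁ x₀, funext hφ₀, funext fun x => ?_⟩
  linear_combination hsymm x x₁ - φ₁ x * hx₁ - hφ₀ x + hφ₀ x₁ + φ₁ x₀ * hx₁

variable {a b c : ℂ} {h : IsConjugationParam a b c} {ψ₀ ψ₁ : ℂ → ℂ}
  {T : FockSpace →ₗ.[ℂ] FockSpace}

theorem kernel_mem_graph_adjoint (hT : T ≤ maximalOperator ![ψ₀, ψ₁])
    (hdense : Dense (T.domain : Set FockSpace)) (w : ℂ) :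
    (FockSpace.kernel w, conj (ψ₀ w) • FockSpace.kernel w + conj (ψ₁ w) • FockSpace.derivKernel w)
      ∈ T.adjoint.graph := by
  rw [mem_graph_adjoint_iff_forall_inner_eq hdense]
  intro x u hx
  have hu := mem_graph_maximalOperator_iff.1 (LinearPMap.le_graph_of_le hT hx)
  rw [← inner_conj_symm, ← inner_conj_symm x, inner_add_left, inner_smul_left, inner_smul_left,
    FockSpace.inner_kernel, FockSpace.inner_kernel, FockSpace.inner_derivKernel, conj_conj,
    conj_conj, hu]

theorem weightedConjugation_kernel (h : IsConjugationParam a b c) (w z : ℂ) :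
    (weightedConjugation h).toLinearMap (FockSpace.kernel w) z
      = c * exp (b * z) * exp (w * (a * z + b)) := by
  rw [weightedConjugation_apply, FockSpace.kernel_apply, ← exp_conj]
  simp only [map_mul, conj_conj]

theorem weightedConjugation_derivKernel (h : IsConjugationParam a b c) (w z : ℂ) :
    (weightedConjugation h).toLinearMap (FockSpace.derivKernel w) z
      = (a * z + b) * (c * exp (b * z) * exp (w * (a * z + b))) := by
  rw [weightedConjugation_apply, FockSpace.derivKernel_apply, map_mul, ← exp_conj]
  simp only [map_mul, conj_conj]
  ring

namespace IsCSelfadjoint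

theorem coeff_symm (hs : IsCSelfadjoint (weightedConjugation h) T)
    (hT : T ≤ maximalOperator ![ψ₀, ψ₁]) (z x : ℂ) :
    ψ₀ z + ψ₁ z * (a * x + b) = ψ₀ x + ψ₁ x * (a * z + b) := by
  have hgraph : ((weightedConjugation h).toLinearMap (FockSpace.kernel z),
      (weightedConjugation h).toLinearMap (conj (ψ₀ z) • FockSpace.kernel z
        + conj (ψ₁ z) • FockSpace.derivKernel z)) ∈ T.graph := by
    rw [hs.2.2, Conjugation.mem_graph_conjugate_iff, Conjugation.apply_apply,
      Conjugation.apply_apply]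
    exact kernel_mem_graph_adjoint hT hs.2.1 z
  have hx := mem_graph_maximalOperator_iff.1 (LinearPMap.le_graph_of_le hT hgraph) x
  rw [map_add, map_smulₛₗ, map_smulₛₗ, FockSpace.add_apply, FockSpace.smul_apply,
    FockSpace.smul_apply, deriv_weightedConjugation, weightedConjugation_kernel,
    weightedConjugation_derivKernel, conj_conj, conj_conj, FockSpace.deriv_kernel,
    FockSpace.kernel_apply] at hx
  simp only [map_mul, ← exp_conj, conj_conj] at hx
  refine mul_left_cancel₀ (mul_ne_zero (h.c_mul_exp_ne_zero x) (exp_ne_zero (z * (a * x + b)))) ?_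
  linear_combination hx

theorem exists_affine (hs : IsCSelfadjoint (weightedConjugation h) T)
    (hT : T ≤ maximalOperator ![ψ₀, ψ₁]) :
    ∃ d₀₀ d₀₁ d₁₁ : ℂ, ψ₀ = (fun z => d₀₀ + d₀₁ * (a * z + b)) ∧
      ψ₁ = fun z => d₀₁ + d₁₁ * (a * z + b) :=
  exists_affine_of_symm (fun y => ⟨(y - b) / a, by field_simp [h.a_ne_zero]; ring⟩)
    (hs.coeff_symm hT)

theorem eq_maximalOperator (hs : IsCSelfadjoint (weightedConjugation h) T)
    (hT : T ≤ maximalOperator ![ψ₀, ψ₁]) : T = maximalOperator ![ψ₀, ψ₁] := by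
  obtain ⟨d₀₀, d₀₁, d₁₁, rfl, rfl⟩ := hs.exists_affine hT
  exact hs.eq_of_le (isCSelfadjoint_maximalOperator h d₀₀ d₀₁ d₁₁) hT

end IsCSelfadjoint

end Necessity

section PointSpectrum

theorem tendsto_sub_mul_logDeriv_nhdsNE {𝕜 : Type*} [NontriviallyNormedField 𝕜]
    [CompleteSpace 𝕜] {f : 𝕜 → 𝕜} {w : 𝕜} (hf : AnalyticAt 𝕜 f w)
    (hfin : analyticOrderAt f w ≠ ⊤) :
    Tendsto (fun z => (z - w) * logDeriv f z) (𝓝[≠] w) (𝓝 (analyticOrderNatAt f w)) := by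
  obtain ⟨g, hg, hgw, hfg⟩ := hf.analyticOrderAt_ne_top.1 hfin
  set k := analyticOrderNatAt f w
  have hlim : Tendsto (fun z => k + (z - w) * (deriv g z / g z)) (𝓝[≠] w) (𝓝 k) := by
    have hcont : ContinuousAt (fun z => k + (z - w) * (deriv g z / g z)) w :=
      continuousAt_const.add <| (continuousAt_id.sub continuousAt_const).mul <|
        hg.deriv.continuousAt.div hg.continuousAt hgw
    simpa using hcont.tendsto.mono_left nhdsWithin_le_nhds
  refine hlim.congr' ?_
  filter_upwards [hfg.eventually_nhds.filter_mono nhdsWithin_le_nhds,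
    hg.eventually_analyticAt.filter_mono nhdsWithin_le_nhds,
    (hg.continuousAt.eventually_ne hgw).filter_mono nhdsWithin_le_nhds, self_mem_nhdsWithin]
    with z hz hgz hgz' hzw
  have hzw' : z - w ≠ 0 := sub_ne_zero.2 hzw
  have hlog : logDeriv f z = k * (1 / (z - w)) + logDeriv g z := by
    rw [(logDeriv_congr_nhds hz).self_of_nhds]
    simp only [smul_eq_mul]
    rw [logDeriv_mul (f := fun z => (z - w) ^ k) z (pow_ne_zero k hzw') hgz' (by fun_prop)
        hgz.differentiableAt,
      logDeriv_fun_pow (by fun_prop)]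
    simp [logDeriv_apply]
  rw [hlog, logDeriv_apply]
  field_simp

theorem FockSpace.analyticOrderAt_ne_top {f : FockSpace} (hf : f ≠ 0) (w : ℂ) :
    analyticOrderAt f w ≠ ⊤ := by
  obtain ⟨z, hz⟩ : ∃ z, f z ≠ 0 := by
    by_contra! h
    exact hf (FockSpace.ext h)
  refine AnalyticOnNhd.analyticOrderAt_ne_top_of_isPreconnected
    (fun z _ => f.differentiable.analyticAt z) isPreconnected_univ (Set.mem_univ z)
    (Set.mem_univ w) ?_
  rw [(f.differentiable.analyticAt z).analyticOrderAt_eq_zero.2 hz]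
  exact ENat.zero_ne_top

theorem FockSpace.eigenvalue_eq_of_simple_zero {ψ₀ : ℂ → ℂ} {f : FockSpace} {w s μ : ℂ}
    (hψ₀ : ContinuousAt ψ₀ w) (hf : f ≠ 0)
    (heigen : ∀ z, μ * f z = ψ₀ z * f z + s * (z - w) * deriv f z) :
    μ = ψ₀ w + analyticOrderNatAt f w * s := by
  have hfw := f.differentiable.analyticAt w
  have hlim : Tendsto (fun z => ψ₀ z + (z - w) * logDeriv f z * s) (𝓝[≠] w)
      (𝓝 (ψ₀ w + analyticOrderNatAt f w * s)) :=
    (hψ₀.tendsto.mono_left nhdsWithin_le_nhds).add <|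
      (tendsto_sub_mul_logDeriv_nhdsNE hfw (analyticOrderAt_ne_top hf w)).mul_const s
  have hne : ∀ᶠ z in 𝓝[≠] w, f z ≠ 0 :=
    hfw.eventually_eq_zero_or_eventually_ne_zero.resolve_left fun h =>
      analyticOrderAt_ne_top hf w (_root_.analyticOrderAt_eq_top.2 h)
  refine tendsto_nhds_unique (tendsto_const_nhds.congr' ?_) hlim
  filter_upwards [hne] with z hz
  refine mul_right_cancel₀ hz ?_
  rw [heigen, logDeriv_apply]
  field_simp

theorem FockSpace.powMulExp_ne_zero (w l : ℂ) (k : ℕ) : powMulExp w l k ≠ 0 := by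
  intro h
  have := congrArg (fun f : FockSpace => f (w + 1)) h
  simp [powMulExp_apply, exp_ne_zero] at this

theorem FockSpace.sub_mul_deriv_powMulExp (w l : ℂ) (k : ℕ) (z : ℂ) :
    (z - w) * deriv (powMulExp w l k) z = (k + (z - w) * l) * powMulExp w l k z := by
  have hderiv : HasDerivAt (powMulExp w l k)
      (k * (z - w) ^ (k - 1) * 1 * exp (l * z) + (z - w) ^ k * (exp (l * z) * (l * 1))) z :=
    (((hasDerivAt_id z).sub_const w).pow k).mul ((hasDerivAt_id z).const_mul l).cexp
  have hpow : (z - w) * (k * (z - w) ^ (k - 1)) = k * (z - w) ^ k := by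
    cases k with
    | zero => simp
    | succ k => rw [Nat.add_sub_cancel]; ring
  rw [hderiv.deriv, powMulExp_apply]
  linear_combination exp (l * z) * hpow

theorem pointSpectrum_maximalOperator_of_ne_zero {a b d₀₀ d₀₁ d₁₁ : ℂ}
    (hd : d₁₁ ≠ 0) {w : ℂ} (hw : d₀₁ + d₁₁ * (a * w + b) = 0) :
    pointSpectrum (maximalOperator
        ![fun z => d₀₀ + d₀₁ * (a * z + b), fun z => d₀₁ + d₁₁ * (a * z + b)])
      = Set.range fun k : ℕ => d₀₀ + d₀₁ * (a * w + b) + k * (a * d₁₁) := by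
  have hψ₁ : (fun z => d₀₁ + d₁₁ * (a * z + b)) = fun z => a * d₁₁ * (z - w) := by
    funext z
    linear_combination hw
  rw [hψ₁]
  ext μ
  rw [mem_pointSpectrum_maximalOperator_iff]
  constructor
  · rintro ⟨f, hf, heigen⟩
    exact ⟨_, (FockSpace.eigenvalue_eq_of_simple_zero (by fun_prop) hf heigen).symm⟩
  · rintro ⟨k, rfl⟩
    refine ⟨FockSpace.powMulExp w (-d₀₁ / d₁₁) k, FockSpace.powMulExp_ne_zero _ _ _, fun z => ?_⟩
    rw [mul_assoc (a * d₁₁), FockSpace.sub_mul_deriv_powMulExp]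
    field_simp
    ring

theorem FockSpace.tendsto_exp_smul_kernel_cobounded (w : ℂ) :
    Tendsto (fun z => Real.exp (-(‖z‖ ^ 2 / 2)) • kernel w z) (Bornology.cobounded ℂ) (𝓝 0) := by
  have hexponent : Tendsto (fun t : ℝ => t * (‖w‖ - t / 2)) atTop atBot :=
    tendsto_id.atTop_mul_atBot₀ <| tendsto_atBot_add_const_left _ ‖w‖ <|
      tendsto_neg_atTop_atBot.comp <| tendsto_id.atTop_div_const two_pos
  refine squeeze_zero_norm (fun z => ?_)
    (Real.tendsto_exp_atBot.comp (hexponent.comp tendsto_norm_cobounded_atTop))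
  have hre : (conj w * z).re ≤ ‖w‖ * ‖z‖ := (re_le_norm _).trans_eq (by simp)
  rw [norm_smul, Real.norm_of_nonneg (Real.exp_nonneg _), kernel_apply, norm_exp, ← Real.exp_add]
  refine Real.exp_le_exp.2 ?_
  simp only [Function.comp_apply]
  linarith

theorem FockSpace.tendsto_exp_smul_cobounded (f : FockSpace) :
    Tendsto (fun z => Real.exp (-(‖z‖ ^ 2 / 2)) • f z) (Bornology.cobounded ℂ) (𝓝 0) := by
  have hspan : ∀ g ∈ Submodule.span ℂ (Set.range kernel),
      Tendsto (fun z => Real.exp (-(‖z‖ ^ 2 / 2)) • g z) (Bornology.cobounded ℂ) (𝓝 0) := by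
    intro g hg
    induction hg using Submodule.span_induction with
    | mem g hg =>
      obtain ⟨w, rfl⟩ := hg
      exact tendsto_exp_smul_kernel_cobounded w
    | zero => simp
    | add g₁ g₂ _ _ h₁ h₂ => simpa [smul_add] using h₁.add h₂
    | smul r g _ hr => simpa [mul_left_comm] using hr.const_mul r
  rw [Metric.tendsto_nhds]
  intro ε hε
  obtain ⟨g, hg, hfg⟩ := Metric.mem_closure_iff.1 (dense_span_range_kernel f) (ε / 2) (half_pos hε)
  filter_upwards [Metric.tendsto_nhds.1 (hspan g hg) (ε / 2) (half_pos hε)] with z hz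
  have hclose : ‖Real.exp (-(‖z‖ ^ 2 / 2)) • (f - g) z‖ ≤ ‖f - g‖ := by
    rw [norm_smul, Real.norm_of_nonneg (Real.exp_nonneg _), Real.exp_neg,
      inv_mul_le_iff₀ (Real.exp_pos _)]
    exact norm_apply_le_exp_mul_norm _ z
  rw [dist_eq_norm] at hfg
  rw [dist_zero_right] at hz ⊢
  calc ‖Real.exp (-(‖z‖ ^ 2 / 2)) • f z‖
      = ‖Real.exp (-(‖z‖ ^ 2 / 2)) • (f - g) z + Real.exp (-(‖z‖ ^ 2 / 2)) • g z‖ := by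
        rw [← smul_add, sub_apply, sub_add_cancel]
    _ ≤ ‖f - g‖ + ‖Real.exp (-(‖z‖ ^ 2 / 2)) • g z‖ := (norm_add_le _ _).trans (by gcongr)
    _ < ε := by linarith

theorem exists_sq_eq_and_re_mul_nonneg (x l : ℂ) : ∃ u : ℂ, u ^ 2 = x ∧ 0 ≤ (l * u).re := by
  obtain ⟨v, hv⟩ := IsAlgClosed.exists_pow_nat_eq x two_pos
  rcases le_total 0 (l * v).re with h | h
  · exact ⟨v, hv, h⟩
  · exact ⟨-v, by rw [neg_sq, hv], by rw [mul_neg, neg_re]; linarith⟩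

theorem eq_mul_exp_sub_of_deriv_eq_mul {𝕜 : Type*} [RCLike 𝕜] [NormedAlgebra 𝕜 ℂ]
    {f P p : 𝕜 → ℂ} (hP : ∀ z, HasDerivAt P (p z) z) (hf : Differentiable 𝕜 f)
    (hode : ∀ z, deriv f z = p z * f z) (w z : 𝕜) : f z = f w * exp (P z - P w) := by
  have hderiv (z : 𝕜) : HasDerivAt (fun z => f z * exp (-P z)) 0 z := by
    have hprod : HasDerivAt (fun z => f z * exp (-P z))
        (p z * f z * exp (-P z) + f z * (exp (-P z) * -p z)) z :=
      (hode z ▸ (hf z).hasDerivAt).mul (hP z).neg.cexp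
    exact hprod.congr_deriv (by ring)
  have hconst : f z * exp (-P z) = f w * exp (-P w) :=
    is_const_of_deriv_eq_zero (fun z => (hderiv z).differentiableAt) (fun z => (hderiv z).deriv) z w
  rw [sub_eq_add_neg, exp_add, mul_left_comm, ← hconst, mul_left_comm, ← exp_add, add_neg_cancel,
    exp_zero, mul_one]

theorem exists_norm_eq_one_and_exp_le_norm_exp {a : ℂ} (ha : ‖a‖ = 1) (l : ℂ) :
    ∃ u : ℂ, ‖u‖ = 1 ∧ ∀ t : ℝ, 0 ≤ t →
      Real.exp (t ^ 2 / 2) ≤ ‖exp (l * (t * u) - a * (t * u) ^ 2 / 2)‖ := by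
  have ha₀ : a ≠ 0 := norm_ne_zero_iff.1 (by rw [ha]; exact one_ne_zero)
  obtain ⟨u, hu, hlu⟩ := exists_sq_eq_and_re_mul_nonneg (-a⁻¹) l
  refine ⟨u, (pow_eq_one_iff_of_nonneg (norm_nonneg u) two_ne_zero).1 ?_, fun t ht => ?_⟩
  · rw [← norm_pow, hu, norm_neg, norm_inv, ha, inv_one]
  · have hexponent : l * (t * u) - a * (t * u) ^ 2 / 2
        = (t : ℂ) * (l * u) + ((t ^ 2 / 2 : ℝ) : ℂ) := by
      rw [mul_pow, hu]
      push_cast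
      field_simp
      ring
    rw [norm_exp, hexponent, add_re, re_ofReal_mul, ofReal_re]
    exact Real.exp_le_exp.2 (le_add_of_nonneg_left (mul_nonneg ht hlu))

theorem FockSpace.eq_zero_of_deriv_eq {a : ℂ} (ha : ‖a‖ = 1) {l : ℂ} {f : FockSpace}
    (hode : ∀ z, deriv f z = (l - a * z) * f z) : f = 0 := by
  have hprim (z : ℂ) : HasDerivAt (fun z => l * z - a * z ^ 2 / 2) (l - a * z) z := by
    have hsub : HasDerivAt (fun z => l * z - a * z ^ 2 / 2)
        (l * 1 - a * (2 * z ^ (2 - 1)) / 2) z :=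
      ((hasDerivAt_id z).const_mul l).sub (((hasDerivAt_pow 2 z).const_mul a).div_const 2)
    exact hsub.congr_deriv (by ring)
  have hf (z : ℂ) : f z = f 0 * exp (l * z - a * z ^ 2 / 2) := by
    simpa using eq_mul_exp_sub_of_deriv_eq_mul hprim f.differentiable hode 0 z
  obtain ⟨u, hu, hgrowth⟩ := exists_norm_eq_one_and_exp_le_norm_exp ha l
  have hray (t : ℝ) (ht : 0 ≤ t) :
      ‖f 0‖ ≤ ‖Real.exp (-(‖t * u‖ ^ 2 / 2)) • f (t * u)‖ := by
    have hnorm : ‖t * u‖ = t := by rw [norm_mul, norm_real, hu, mul_one, Real.norm_of_nonneg ht]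
    rw [hf (t * u), hnorm, norm_smul, norm_mul, Real.norm_of_nonneg (Real.exp_nonneg _),
      Real.exp_neg, ← div_eq_inv_mul, le_div_iff₀ (Real.exp_pos _)]
    exact mul_le_mul_of_nonneg_left (hgrowth t ht) (norm_nonneg _)
  have hcobounded : Tendsto (fun t : ℝ => (t : ℂ) * u) atTop (Bornology.cobounded ℂ) := by
    rw [← tendsto_norm_atTop_iff_cobounded]
    simpa [hu] using tendsto_abs_atTop_atTop
  have hzero : ‖f 0‖ ≤ ‖(0 : ℂ)‖ :=
    ge_of_tendsto (f.tendsto_exp_smul_cobounded.comp hcobounded).norm <| by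
      filter_upwards [eventually_ge_atTop 0] with t ht using hray t ht
  ext z
  rw [hf, norm_le_zero_iff.1 (hzero.trans_eq norm_zero), zero_mul, zero_apply]

theorem pointSpectrum_maximalOperator_eq_empty {a b d₀₀ d₀₁ : ℂ} (ha : ‖a‖ = 1) (hd : d₀₁ ≠ 0) :
    pointSpectrum (maximalOperator ![fun z => d₀₀ + d₀₁ * (a * z + b), fun _ => d₀₁]) = ∅ := by
  refine Set.eq_empty_of_forall_notMem fun μ hμ => ?_
  obtain ⟨f, hf, heigen⟩ := mem_pointSpectrum_maximalOperator_iff.1 hμ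
  have hode (z : ℂ) : deriv f z = ((μ - d₀₀) / d₀₁ - b - a * z) * f z := by
    field_simp
    linear_combination -heigen z
  exact hf (FockSpace.eq_zero_of_deriv_eq ha hode)

theorem pointSpectrum_maximalOperator_const (d : ℂ) :
    pointSpectrum (maximalOperator ![fun _ => d, fun _ => 0]) = {d} := by
  ext μ
  rw [mem_pointSpectrum_maximalOperator_iff, Set.mem_singleton_iff]
  constructor
  · rintro ⟨f, hf, heigen⟩
    by_contra hμ
    refine hf (FockSpace.ext fun z => ?_)
    simpa [hμ] using heigen z
  · rintro rfl
    exact ⟨_, FockSpace.powMulExp_ne_zero 0 0 0, fun z => by ring⟩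

end PointSpectrum

theorem deriv_const_add_mul_affine (a b c d w : ℂ) :
    deriv (fun z => c + d * (a * z + b)) w = a * d := by
  have h : HasDerivAt (fun z => c + d * (a * z + b)) (d * (a * 1)) w :=
    ((((hasDerivAt_id w).const_mul a).add_const b).const_mul d).const_add c
  rw [h.deriv]
  ring

theorem corollary6p11_general (a b c : ℂ) (habc : IsConjugationParam a b c)
    (ψ₀ ψ₁ : ℂ → ℂ) (T : FockSpace →ₗ.[ℂ] FockSpace) (hT : T ≤ maximalOperator ![ψ₀, ψ₁]) :
    (IsCSelfadjoint (weightedConjugation habc) T ↔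
      T = maximalOperator ![ψ₀, ψ₁] ∧
        ∃ d₀₀ d₁₀ d₀₁ d₁₁ : ℂ, d₁₀ = d₀₁ ∧
          (∀ z, ψ₀ z = d₀₀ + d₁₀ * (a * z + b)) ∧ (∀ z, ψ₁ z = d₀₁ + d₁₁ * (a * z + b))) ∧
    (IsCSelfadjoint (weightedConjugation habc) T →
      ∀ d₀₀ d₁₀ d₀₁ d₁₁ : ℂ, d₁₀ = d₀₁ →
        (∀ z, ψ₀ z = d₀₀ + d₁₀ * (a * z + b)) → (∀ z, ψ₁ z = d₀₁ + d₁₁ * (a * z + b)) →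
          (d₁₁ ≠ 0 → pointSpectrum T = Set.range fun k : ℕ =>
            ψ₀ ((-d₀₁ - b * d₁₁) / (a * d₁₁)) + k * deriv ψ₁ ((-d₀₁ - b * d₁₁) / (a * d₁₁))) ∧
          (d₁₁ = 0 → d₀₁ ≠ 0 → pointSpectrum T = ∅) ∧
          (d₁₁ = 0 → d₀₁ = 0 → pointSpectrum T = {d₀₀})) := by
  refine ⟨⟨fun hs => ⟨hs.eq_maximalOperator hT, ?_⟩, ?_⟩, fun hs => ?_⟩
  · obtain ⟨d₀₀, d₀₁, d₁₁, rfl, rfl⟩ := hs.exists_affine hT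
    exact ⟨d₀₀, d₀₁, d₀₁, d₁₁, rfl, fun _ => rfl, fun _ => rfl⟩
  · rintro ⟨rfl, d₀₀, d₀₁, _, d₁₁, rfl, hψ₀, hψ₁⟩
    rw [funext hψ₀, funext hψ₁]
    exact isCSelfadjoint_maximalOperator habc d₀₀ d₀₁ d₁₁
  · rintro d₀₀ d₀₁ _ d₁₁ rfl hψ₀ hψ₁
    rw [hs.eq_maximalOperator hT, funext hψ₀, funext hψ₁]
    refine ⟨fun hd => ?_, ?_, ?_⟩
    · have ha := habc.a_ne_zero
      simp only [deriv_const_add_mul_affine]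
      exact pointSpectrum_maximalOperator_of_ne_zero hd (by field_simp; ring)
    · rintro rfl hd
      simpa only [zero_mul, add_zero] using pointSpectrum_maximalOperator_eq_empty habc.1 hd
    · rintro rfl rfl
      simpa only [zero_mul, add_zero] using pointSpectrum_maximalOperator_const d₀₀

theorem corollary6p11 (a b c : ℂ) (habc : IsConjugationParam a b c)
    (ψ₀ ψ₁ : ℂ → ℂ) (hψ₀ : Differentiable ℂ ψ₀) (hψ₁ : Differentiable ℂ ψ₁)
    (T : FockSpace →ₗ.[ℂ] FockSpace) (hT : T ≤ maximalOperator ![ψ₀, ψ₁]) :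
    (IsCSelfadjoint (weightedConjugation habc) T ↔
      T = maximalOperator ![ψ₀, ψ₁] ∧
        ∃ d₀₀ d₁₀ d₀₁ d₁₁ : ℂ, d₁₀ = d₀₁ ∧
          (∀ z, ψ₀ z = d₀₀ + d₁₀ * (a * z + b)) ∧ (∀ z, ψ₁ z = d₀₁ + d₁₁ * (a * z + b))) ∧
    (IsCSelfadjoint (weightedConjugation habc) T →
      ∀ d₀₀ d₁₀ d₀₁ d₁₁ : ℂ, d₁₀ = d₀₁ →
        (∀ z, ψ₀ z = d₀₀ + d₁₀ * (a * z + b)) → (∀ z, ψ₁ z = d₀₁ + d₁₁ * (a * z + b)) →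
          (d₁₁ ≠ 0 → pointSpectrum T = Set.range fun k : ℕ =>
            ψ₀ ((-d₀₁ - b * d₁₁) / (a * d₁₁)) + k * deriv ψ₁ ((-d₀₁ - b * d₁₁) / (a * d₁₁))) ∧
          (d₁₁ = 0 → d₀₁ ≠ 0 → pointSpectrum T = ∅) ∧
          (d₁₁ = 0 → d₀₁ = 0 → pointSpectrum T = {d₀₀})) :=
  corollary6p11_general a b c habc ψ₀ ψ₁ T hT
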